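/- **Theorem 1 (Rademacher's formula).** Let $p(n)$ denote the number of partitions of $n$. For every positive integer $n$, $$p(n)=\frac{1}{\pi\sqrt2}\sum_{c=1}^{\infty}A_c(n)\,\sqrt c\;\frac{d}{dn}\left[\frac{\sinh\!\big(\mu\sqrt{n-1/24}\,/c\big)}{\sqrt{n-1/24}}\right],$$ where the series converges absolutely, $\mu=\pi\sqrt{2/3}$, the derivative is that of the displayed function of a real variable, taken at the integer $n$, and the coefficients are $$A_c(n)=e^{\pi i/4}\,A\!\left(-\tfrac1{24},\,n-\tfrac1{24};\,c\right).$$ Here, for $m\in\frac1{24}\mathbb Z$, $\nu\in m+\mathbb Z$ and an integer $c\ge1$, $A(m,\nu;c)$ is the generalized Kloosterman sum $$A(m,\nu;c)=\sum_{\substack{d\ (\mathrm{mod}\ c)\\ \gcd(c,d)=1}} v_\eta(M)^{-24m}\,e^{2\pi i\frac{ma+\nu d}{c}},\qquad M=\begin{pmatrix}a&*\\ c&d\end{pmatrix}\in SL_2(\mathbb Z),$$ whose summands do not depend on the choice of $M$ and of the representative $d$. The eta multiplier $v_\eta$ is defined by $$\eta(M\tau)=v_\eta(M)\sqrt{c\tau+d}\;\eta(\tau)\qquad\text{for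 all }\tau\in\mathbb H,\ M=\begin{pmatrix}*&*\\ c&d\end{pmatrix}\in SL_2(\mathbb Z),$$ where $\eta(\tau)=e^{2\pi i\tau/24}\prod_{k\ge1}(1-e^{2\pi i k\tau})$ is the Dedekind eta function and the square root is taken with $-\pi\le\arg z<\pi$. -/

import Mathlib

open scoped MatrixGroups UpperHalfPlane

noncomputable section

namespace Rademacher

/-- The square root of a complex number `z`, extracted with the convention `-π ≤ arg z < π`.
It differs from the principal power `z ^ (1/2)` (for which `-π < arg z ≤ π`) exactly on the
negative real axis, and there by a sign. -/
def csqrt (z : ℂ) : ℂ :=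
  if z.arg = Real.pi then -(z ^ (1 / 2 : ℂ)) else z ^ (1 / 2 : ℂ)

theorem csqrt_sq (z : ℂ) : csqrt z ^ 2 = z := by
  have h : (z ^ (1 / 2 : ℂ)) ^ 2 = z := by
    simp
  unfold csqrt
  split_ifs
  · rw [neg_sq, h]
  · exact h

theorem csqrt_ne_zero {z : ℂ} (hz : z ≠ 0) : csqrt z ≠ 0 := fun h => hz <| by
  rw [← csqrt_sq z, h]; simp

theorem continuousAt_csqrt {z : ℂ} (hz : z ∈ Complex.slitPlane) : ContinuousAt csqrt z := by
  have h1 : ContinuousAt (fun w : ℂ => w ^ (1 / 2 : ℂ)) z :=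
    continuousAt_id.cpow continuousAt_const hz
  refine h1.congr ?_
  filter_upwards [Complex.isOpen_slitPlane.mem_nhds hz] with w hw
  simp [csqrt, (Complex.mem_slitPlane_iff_arg.mp hw).1]

theorem eta_smul_pow (M : SL(2, ℤ)) (τ : ℍ) :
    ModularForm.eta ((M • τ : ℍ) : ℂ) ^ 24
      = ((M 1 0 : ℂ) * (τ : ℂ) + (M 1 1 : ℂ)) ^ 12 * ModularForm.eta (τ : ℂ) ^ 24 := by
  have h := congrFun (SlashInvariantForm.slash_action_generators_SL2Z
    ModularForm.discriminant_S_invariant ModularForm.discriminant_T_invariant M) τ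
  rw [ModularForm.SL_slash_apply] at h
  have hd := UpperHalfPlane.denom_ne_zero (M : GL (Fin 2) ℝ) τ
  have h2 : ModularForm.discriminant (M • τ)
      = UpperHalfPlane.denom (M : GL (Fin 2) ℝ) τ ^ 12 * ModularForm.discriminant τ := by
    rw [← h, zpow_neg, mul_comm (ModularForm.discriminant _)]
    exact (mul_inv_cancel_left₀ (pow_ne_zero 12 hd) _).symm
  simpa [ModularForm.discriminant, UpperHalfPlane.denom] using h2

/-- For every `M = [* *; c d]` in the modular group there is a unique constant `v`
such that `η(Mτ) = v √(cτ + d) η(τ)` on the upper half plane. -/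
theorem existsUnique_etaMultiplier (M : SL(2, ℤ)) :
    ∃! v : ℂ, ∀ τ : ℍ, ModularForm.eta ((M • τ : ℍ) : ℂ)
      = v * csqrt ((M 1 0 : ℂ) * (τ : ℂ) + (M 1 1 : ℂ)) * ModularForm.eta (τ : ℂ) := by
  have hη : ∀ τ : ℍ, ModularForm.eta (τ : ℂ) ≠ 0 := fun τ => ModularForm.eta_ne_zero τ.2
  have hηc : Continuous fun τ : ℍ => ModularForm.eta (τ : ℂ) :=
    continuous_iff_continuousAt.mpr fun τ =>
      (ModularForm.differentiableAt_eta_of_mem_upperHalfPlaneSet τ.2).continuousAt.comp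
        UpperHalfPlane.continuous_coe.continuousAt
  have hd : ∀ τ : ℍ, (M 1 0 : ℂ) * (τ : ℂ) + (M 1 1 : ℂ) ≠ 0 := fun τ => by
    have := UpperHalfPlane.denom_ne_zero (M : GL (Fin 2) ℝ) τ
    simpa [UpperHalfPlane.denom] using this
  have hs : ∀ τ : ℍ, csqrt ((M 1 0 : ℂ) * (τ : ℂ) + (M 1 1 : ℂ)) ≠ 0 :=
    fun τ => csqrt_ne_zero (hd τ)
  have hsc : Continuous fun τ : ℍ => csqrt ((M 1 0 : ℂ) * (τ : ℂ) + (M 1 1 : ℂ)) := by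
    by_cases hc : M 1 0 = 0
    · simpa [hc] using continuous_const
    · refine continuous_iff_continuousAt.mpr fun τ => ?_
      have hm : (M 1 0 : ℂ) * (τ : ℂ) + (M 1 1 : ℂ) ∈ Complex.slitPlane := by
        refine Or.inr ?_
        simpa using ⟨hc, τ.im_ne_zero⟩
      have h2 : ContinuousAt (fun τ : ℍ => (M 1 0 : ℂ) * (τ : ℂ) + (M 1 1 : ℂ)) τ := by
        fun_prop
      exact ContinuousAt.comp (f := fun τ : ℍ => (M 1 0 : ℂ) * (τ : ℂ) + (M 1 1 : ℂ))
        (continuousAt_csqrt hm) h2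
  let f : ℍ → ℂ := fun τ => ModularForm.eta ((M • τ : ℍ) : ℂ) /
    (csqrt ((M 1 0 : ℂ) * (τ : ℂ) + (M 1 1 : ℂ)) * ModularForm.eta (τ : ℂ))
  have hf : Continuous f :=
    (hηc.comp (continuous_const_smul (M : GL (Fin 2) ℝ))).div (hsc.mul hηc) fun τ => mul_ne_zero (hs τ) (hη τ)
  have hf1 : ∀ τ, f τ ^ 24 = 1 := fun τ => by
    have h24 : csqrt ((M 1 0 : ℂ) * (τ : ℂ) + (M 1 1 : ℂ)) ^ 24
        = ((M 1 0 : ℂ) * (τ : ℂ) + (M 1 1 : ℂ)) ^ 12 := by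
      rw [show 24 = 2 * 12 from rfl, pow_mul, csqrt_sq]
    simp only [f]
    rw [div_pow, mul_pow, eta_smul_pow, h24]
    exact div_self (mul_ne_zero (pow_ne_zero _ (hd τ)) (pow_ne_zero _ (hη τ)))
  have hfin : {z : ℂ | z ^ 24 = 1}.Finite := by
    refine (Polynomial.nthRoots 24 (1 : ℂ)).toFinset.finite_toSet.subset fun z hz => ?_
    simpa [Polynomial.mem_nthRoots] using hz
  have hconst : ∀ τ, f τ = f UpperHalfPlane.I := fun τ =>
    isPreconnected_univ.constant_of_mapsTo hfin.isDiscrete hf.continuousOn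
      (fun τ _ => hf1 τ) (Set.mem_univ _) (Set.mem_univ _)
  refine ⟨f UpperHalfPlane.I, fun τ => ?_, fun v hv => ?_⟩
  · rw [← hconst τ, mul_assoc]
    exact (div_mul_cancel₀ _ (mul_ne_zero (hs τ) (hη τ))).symm
  · rw [eq_div_iff (mul_ne_zero (hs _) (hη _)), hv UpperHalfPlane.I, mul_assoc]

/-- The eta multiplier `v_η`: the constant in
`η(Mτ) = v_η(M) √(cτ + d) η(τ)`, for `M = [* *; c d]` in the modular group. -/
def etaMultiplier (M : SL(2, ℤ)) : ℂ := (existsUnique_etaMultiplier M).choose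

/-- A matrix `[a *; c d]` in the modular group with the bottom row `c d`, for coprime `c`, `d`
(and the identity matrix as a default value if `c`, `d` are not coprime). -/
def matrixOfBottomRow (c d : ℤ) : SL(2, ℤ) :=
  if h : Int.gcd d c = 1 then
    ⟨!![Int.gcdA d c, -Int.gcdB d c; c, d], by
      have := Int.gcd_eq_gcd_ab d c
      rw [h] at this
      rw [Matrix.det_fin_two_of]
      push_cast at this
      linarith⟩
  else 1

/-- The generalized Kloosterman sum
`A(m, n; c) = ∑ v_η(M) ^ (-24 m) e ^ (2 π i (m a + n d) / c)`, where `d` runs over the residues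
modulo `c` that are coprime to `c` and `M = [a *; c d]` is in the modular group.
The sum is used for `24 m ∈ ℤ` and `n - m ∈ ℤ`; then the exponent `-24 m` is an integer, and the
summands do not depend on the choice of `M` and of the representative `d`. -/
def kloostermanSum (m n : ℚ) (c : ℕ) : ℂ :=
  ∑ d ∈ (Finset.range c).filter (fun d => Nat.Coprime c d),
    etaMultiplier (matrixOfBottomRow c d) ^ (-24 * (m : ℂ)) *
      Complex.exp (2 * Real.pi * Complex.I *
        (((m : ℂ) * (matrixOfBottomRow c d 0 0 : ℂ) + (n : ℂ) * (d : ℂ)) / (c : ℂ)))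

/-- `A_c(n) = e ^ (π i / 4) A(-1/24, n - 1/24; c)`. -/
def A (c n : ℕ) : ℂ :=
  Complex.exp (Real.pi * Complex.I / 4) * kloostermanSum (-1 / 24) ((n : ℚ) - 1 / 24) c

/-- The constant `μ = π √(2/3)`. -/
def mu : ℝ := Real.pi * Real.sqrt (2 / 3)

/-- The partition function: the number of ways to write `n` as an unordered sum of positive
integers. -/
def p (n : ℕ) : ℕ := Fintype.card (Nat.Partition n)

end Rademacher

end

/-!
The proof is the circle method with a Farey dissection. The number `p n` is the integral of
`e ^ (-2 π i n τ) ∏ (1 - e ^ (2 π i k τ))⁻¹` over a period of the horizontal line of height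
`1 / N ^ 2`, and the Farey fractions of order `N` with their mediants cut this period into arcs,
each running from a cusp `-d / k` to a neighbouring mediant. In the coordinate `w` with
`τ = -d / k + i / (k ^ 2 w)`, the transformation law of `η` turns the integrand into an elementary
main term times the same product at a point `q` with `|q| = e ^ (-2 π Re w)`, and `Re w ≥ 1 / 2` on
the arc, so that setting this product to `1` costs `O(N ^ (-3 / 2) / k)` per arc. As `dτ` is
proportional to `w ^ (-2) dw`, the main term becomes `w ^ (-5 / 2) exp (π w / 12 + b / w)`, whose
integral from a mediant vertically to infinity is small as well. The arcs with denominator `k` thus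
add up to `A_k(n)` times the integral over a full vertical line; there are at most `2 k` of them, so
the total error is `O(N ^ (-1 / 2))`.

The line integral is evaluated by expanding `exp (b / w)` and inverting the Fourier transform of
the Gamma density in each term. By Legendre's duplication formula the resulting power series is
that of the derivative of `sinh (κ √y) / √y`.
-/

open scoped MatrixGroups UpperHalfPlane

noncomputable section

namespace Rademacher

/-! ### The generating function of the partition numbers -/

section GeneratingFunction

open Filter Topology Finset
open scoped PowerSeries.WithPiTopology

/-- Absolute convergence of the formal power series `F` at the point `q`, with sum `v`; it lets
products of formal power series be evaluated factor by factor. -/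
def HasAbsSumAt {R : Type*} [NormedRing R] (F : PowerSeries R) (q v : R) : Prop :=
  Summable (fun m => ‖F.coeff m * q ^ m‖) ∧ HasSum (fun m => F.coeff m * q ^ m) v

namespace HasAbsSumAt

variable {R : Type*} [NormedCommRing R] {q : R}

theorem one (q : R) : HasAbsSumAt 1 q 1 := by
  have hne : ∀ m ≠ 0, (1 : PowerSeries R).coeff m * q ^ m = 0 := fun m hm => by
    simp [PowerSeries.coeff_one, hm]
  refine ⟨summable_of_ne_finset_zero (s := {0}) fun m hm => ?_, ?_⟩
  · rw [hne m (by simpa using hm), norm_zero]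
  · simpa using hasSum_single 0 hne

variable [CompleteSpace R]

theorem mul {F G : PowerSeries R} {v w : R} (hF : HasAbsSumAt F q v) (hG : HasAbsSumAt G q w) :
    HasAbsSumAt (F * G) q (v * w) := by
  have cauchy : ∀ m, ∑ kl ∈ antidiagonal m,
      F.coeff kl.1 * q ^ kl.1 * (G.coeff kl.2 * q ^ kl.2) = (F * G).coeff m * q ^ m := fun m => by
    rw [PowerSeries.coeff_mul, Finset.sum_mul]
    refine Finset.sum_congr rfl fun kl hkl => ?_
    rw [← mem_antidiagonal.mp hkl, pow_add]
    ring
  have hsummable := summable_norm_sum_mul_antidiagonal_of_summable_norm hF.1 hG.1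
  have htsum := tsum_mul_tsum_eq_tsum_sum_antidiagonal_of_summable_norm hF.1 hG.1
  simp only [cauchy] at hsummable htsum
  rw [hF.2.tsum_eq, hG.2.tsum_eq] at htsum
  exact ⟨hsummable, htsum ▸ hsummable.of_norm.hasSum⟩

theorem prod {ι : Type*} (s : Finset ι) {F : ι → PowerSeries R} {v : ι → R}
    (h : ∀ i ∈ s, HasAbsSumAt (F i) q (v i)) :
    HasAbsSumAt (∏ i ∈ s, F i) q (∏ i ∈ s, v i) := by
  classical
  induction s using Finset.induction_on with
  | empty => simpa using one q
  | insert i s his ih =>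
    rw [prod_insert his, prod_insert his]
    exact (h i (mem_insert_self _ _)).mul (ih fun j hj => h j (mem_insert_of_mem hj))

end HasAbsSumAt

theorem coeff_tsum_X_pow {R : Type*} [CommRing R] [TopologicalSpace R] [T2Space R] {k : ℕ}
    (hk : k ≠ 0) (m : ℕ) :
    (∑' j : ℕ, (PowerSeries.X : PowerSeries R) ^ (k * j)).coeff m = if k ∣ m then 1 else 0 := by
  have hs : Summable fun j : ℕ => (PowerSeries.X : PowerSeries R) ^ (k * j) := by
    simp_rw [pow_mul]
    exact PowerSeries.WithPiTopology.summable_pow_of_constantCoeff_eq_zero (by simp [hk])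
  rw [hs.map_tsum (PowerSeries.coeff m) (PowerSeries.WithPiTopology.continuous_coeff R m)]
  simp only [PowerSeries.coeff_X_pow]
  split_ifs with h
  · obtain ⟨j, rfl⟩ := h
    rw [tsum_eq_single j fun i hi => by simp [hk, Ne.symm hi], if_pos rfl]
  · exact (tsum_congr fun j => if_neg fun hj => h (Dvd.intro j hj.symm)).trans tsum_zero

theorem card_restricted_le (n K : ℕ) : #(Nat.Partition.restricted n (· ≤ K)) ≤ p n :=
  card_le_univ _

theorem card_restricted_of_le {n K : ℕ} (h : n ≤ K) :
    #(Nat.Partition.restricted n (· ≤ K)) = p n := by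
  rw [p, ← card_univ, Nat.Partition.restricted, filter_true_of_mem]
  exact fun x _ i hi => (Nat.Partition.le_of_mem_parts hi).trans h

/-- Euler's product `∏ (1 - q ^ k)⁻¹` over `k ≥ 1`, the generating function of the partition
numbers. -/
def partGen {𝕜 : Type*} [NormedField 𝕜] (q : 𝕜) : 𝕜 := (∏' k : ℕ, (1 - q ^ (k + 1)))⁻¹

variable {𝕜 : Type*} [NormedField 𝕜] {q : 𝕜}

theorem hasAbsSumAt_tsum_X_pow {k : ℕ} (hk : k ≠ 0) (hq : ‖q‖ < 1) :
    HasAbsSumAt (∑' j : ℕ, (PowerSeries.X : PowerSeries 𝕜) ^ (k * j)) q (1 - q ^ k)⁻¹ := by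
  have hqk : ‖q ^ k‖ < 1 := by
    rw [norm_pow]
    exact pow_lt_one₀ (norm_nonneg _) hq hk
  refine ⟨Summable.of_nonneg_of_le (fun _ => norm_nonneg _) (fun m => ?_)
    (summable_geometric_of_lt_one (norm_nonneg q) hq), ?_⟩
  · rw [coeff_tsum_X_pow hk, norm_mul, norm_pow]
    split_ifs <;> simp
  · rw [← (mul_right_injective₀ hk).hasSum_iff]
    · refine (hasSum_geometric_of_norm_lt_one hqk).congr_fun fun j => ?_
      rw [Function.comp_apply, coeff_tsum_X_pow hk, if_pos (Dvd.intro _ rfl), one_mul, pow_mul]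
    · intro m hm
      rw [coeff_tsum_X_pow hk, if_neg, zero_mul]
      rintro ⟨j, rfl⟩
      exact hm ⟨j, rfl⟩

theorem summable_norm_neg_pow_succ (hq : ‖q‖ < 1) : Summable fun k : ℕ => ‖-q ^ (k + 1)‖ := by
  simpa using (summable_nat_add_iff 1).mpr (summable_geometric_of_lt_one (norm_nonneg _) hq)

variable [CompleteSpace 𝕜]

theorem hasAbsSumAt_card_restricted (K : ℕ) (hq : ‖q‖ < 1) :
    HasAbsSumAt (PowerSeries.mk fun n => (#(Nat.Partition.restricted n (· ≤ K)) : 𝕜)) q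
      (∏ i ∈ range K, (1 - q ^ (i + 1)))⁻¹ := by
  have hfin := hasProd_prod_of_ne_finset_one (L := .unconditional ℕ) (s := range K)
    (f := fun i => if i + 1 ≤ K then
      ∑' j : ℕ, (PowerSeries.X : PowerSeries 𝕜) ^ ((i + 1) * j) else 1) fun i hi => by
      rw [if_neg]
      simpa using hi
  rw [(Nat.Partition.hasProd_powerSeriesMk_card_restricted 𝕜 (· ≤ K)).unique hfin,
    ← prod_inv_distrib]
  refine HasAbsSumAt.prod _ fun i hi => ?_
  rw [if_pos (by simpa using hi)]
  exact hasAbsSumAt_tsum_X_pow i.succ_ne_zero hq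

theorem tprod_one_sub_pow_ne_zero (hq : ‖q‖ < 1) : ∏' k : ℕ, (1 - q ^ (k + 1)) ≠ 0 := by
  simp only [sub_eq_add_neg]
  refine tprod_one_add_ne_zero_of_summable (fun k h => ?_) (summable_norm_neg_pow_succ hq)
  have hpow : ‖q ^ (k + 1)‖ < 1 := by
    rw [norm_pow]
    exact pow_lt_one₀ (norm_nonneg _) hq k.succ_ne_zero
  rw [← sub_eq_add_neg, sub_eq_zero] at h
  rw [← h, norm_one] at hpow
  exact lt_irrefl _ hpow

theorem tendsto_prod_range_partGen (hq : ‖q‖ < 1) :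
    Tendsto (fun K => (∏ i ∈ range K, (1 - q ^ (i + 1)))⁻¹) atTop (𝓝 (partGen q)) := by
  have hmul := multipliable_one_add_of_summable (f := fun k => -q ^ (k + 1))
    (summable_norm_neg_pow_succ hq)
  simp only [← sub_eq_add_neg] at hmul
  exact hmul.hasProd.tendsto_prod_nat.inv₀ (tprod_one_sub_pow_ne_zero hq)

theorem summable_p_mul_pow {r : ℝ} (hr0 : 0 ≤ r) (hr : r < 1) :
    Summable fun m => (p m : ℝ) * r ^ m := by
  have hr' : ‖r‖ < 1 := by rwa [Real.norm_of_nonneg hr0]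
  obtain ⟨C, hC⟩ := (tendsto_prod_range_partGen hr').bddAbove_range
  refine summable_of_sum_range_le (c := C) (fun m => by positivity) fun M => ?_
  have hsum := (hasAbsSumAt_card_restricted M hr').2
  simp only [PowerSeries.coeff_mk] at hsum
  calc ∑ m ∈ range M, (p m : ℝ) * r ^ m
      = ∑ m ∈ range M, (#(Nat.Partition.restricted m (· ≤ M)) : ℝ) * r ^ m :=
        sum_congr rfl fun m hm => by rw [card_restricted_of_le (mem_range.mp hm).le]
    _ ≤ _ := sum_le_hasSum _ (fun m _ => by positivity) hsum
    _ ≤ C := hC ⟨M, rfl⟩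

theorem hasSum_partGen (hq : ‖q‖ < 1) : HasSum (fun m => (p m : 𝕜) * q ^ m) (partGen q) := by
  have hdom := summable_p_mul_pow (norm_nonneg q) hq
  have hle : ∀ j m : ℕ, j ≤ p m → ‖(j : 𝕜) * q ^ m‖ ≤ p m * ‖q‖ ^ m := fun j m hj => by
    rw [norm_mul, norm_pow]
    gcongr
    simpa using (Nat.norm_cast_le (α := 𝕜) j).trans (by simpa using hj)
  have hlim : Tendsto (fun K => ∑' m, (#(Nat.Partition.restricted m (· ≤ K)) : 𝕜) * q ^ m) atTop
      (𝓝 (∑' m, (p m : 𝕜) * q ^ m)) := by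
    refine tendsto_tsum_of_dominated_convergence hdom (fun m => ?_)
      (.of_forall fun K m => hle _ _ (card_restricted_le m K))
    refine tendsto_const_nhds.congr' ?_
    filter_upwards [eventually_ge_atTop m] with K hK
    rw [card_restricted_of_le hK]
  have hfin : ∀ K, ∑' m, (#(Nat.Partition.restricted m (· ≤ K)) : 𝕜) * q ^ m
      = (∏ i ∈ range K, (1 - q ^ (i + 1)))⁻¹ := fun K => by
    simpa using (hasAbsSumAt_card_restricted K hq).2.tsum_eq
  simp only [hfin] at hlim
  rw [tendsto_nhds_unique (tendsto_prod_range_partGen hq) hlim]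
  exact (hdom.of_norm_bounded fun m => hle _ m le_rfl).hasSum

theorem exists_norm_partGen_sub_one_le {r : ℝ} (hr0 : 0 < r) (hr : r < 1) :
    ∃ C : ℝ, 0 ≤ C ∧ ∀ q : 𝕜, ‖q‖ ≤ r → ‖partGen q - 1‖ ≤ C * ‖q‖ := by
  have hs : Summable fun m => (p (m + 1) : ℝ) * r ^ m := by
    refine (((summable_nat_add_iff 1).mpr (summable_p_mul_pow hr0.le hr)).mul_right r⁻¹).congr
      fun m => ?_
    rw [pow_succ]
    field_simp
  refine ⟨∑' m, (p (m + 1) : ℝ) * r ^ m, tsum_nonneg fun m => by positivity, fun q hq => ?_⟩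
  have h0 : (p 0 : 𝕜) = 1 := by simp [p]
  have htail := (hasSum_nat_add_iff' (f := fun m => (p m : 𝕜) * q ^ m) 1).mpr
    (hasSum_partGen (hq.trans_lt hr))
  simp only [sum_range_one, h0, pow_zero, mul_one] at htail
  have hbound := hs.hasSum.mul_right ‖q‖
  refine htail.norm_le_of_bounded hbound fun m => ?_
  rw [norm_mul, norm_pow, pow_succ, ← mul_assoc]
  gcongr
  simpa using Nat.norm_cast_le (α := 𝕜) (p (m + 1))

theorem continuousOn_partGen : ContinuousOn (partGen : ℂ → ℂ) (Metric.ball 0 1) :=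
  ModularForm.differentiableOn_tprod_one_sub_pow.continuousOn.inv₀ fun _ hq =>
    tprod_one_sub_pow_ne_zero (by simpa using hq)

end GeneratingFunction

/-! ### The partition numbers as integrals over a horizontal segment -/

section Integrand

open Complex

/-- The function `e ^ (-2 π i n τ) ∏ (1 - e ^ (2 π i k τ))⁻¹` of `τ` in the upper half plane, whose
zeroth Fourier coefficient is `p n`. -/
def integrand (n : ℕ) (τ : ℂ) : ℂ :=
  exp (-(2 * Real.pi * I * n * τ)) * partGen (exp (2 * Real.pi * I * τ))

theorem integrand_add_one (n : ℕ) (τ : ℂ) : integrand n (τ + 1) = integrand n τ := by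
  have hgen : exp (2 * Real.pi * I * (τ + 1)) = exp (2 * Real.pi * I * τ) := by
    rw [mul_add, mul_one, exp_periodic]
  have hexp : exp (-(2 * Real.pi * I * n * (τ + 1))) = exp (-(2 * Real.pi * I * n * τ)) := by
    rw [show -(2 * Real.pi * I * n * (τ + 1))
        = -(2 * Real.pi * I * n * τ) + -(n * (2 * Real.pi * I)) by ring,
      exp_add, exp_neg (n * _), exp_nat_mul_two_pi_mul_I, inv_one, mul_one]
  rw [integrand, hgen, hexp, integrand]

theorem norm_exp_two_pi_I_mul (τ : ℂ) :
    ‖exp (2 * Real.pi * I * τ)‖ = Real.exp (-(2 * Real.pi * τ.im)) := by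
  rw [norm_exp]
  congr 1
  simp

theorem norm_exp_two_pi_I_mul_lt_one {τ : ℂ} (hτ : 0 < τ.im) :
    ‖exp (2 * Real.pi * I * τ)‖ < 1 := by
  rw [norm_exp_two_pi_I_mul, Real.exp_lt_one_iff, neg_lt_zero]
  exact mul_pos Real.two_pi_pos hτ

theorem continuousOn_integrand (n : ℕ) : ContinuousOn (integrand n) {τ | 0 < τ.im} := by
  refine ContinuousOn.mul (by fun_prop) (continuousOn_partGen.comp (by fun_prop) fun τ hτ => ?_)
  simpa using norm_exp_two_pi_I_mul_lt_one hτ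

theorem continuous_integrand_line (n : ℕ) {y : ℝ} (hy : 0 < y) :
    Continuous fun x : ℝ => integrand n (x + y * I) :=
  (continuousOn_integrand n).comp_continuous (by fun_prop) fun x => by simpa using hy

theorem hasSum_integrand (n : ℕ) {τ : ℂ} (hτ : 0 < τ.im) :
    HasSum (fun m : ℕ => p m * exp (2 * Real.pi * I * ((m - n : ℤ) * τ))) (integrand n τ) := by
  refine ((hasSum_partGen (norm_exp_two_pi_I_mul_lt_one hτ)).mul_left _).congr_fun fun m => ?_
  rw [mul_left_comm (exp _), ← exp_nat_mul, ← exp_add]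
  congr 2
  push_cast
  ring

theorem integral_exp_int_mul_add (k : ℤ) (z : ℂ) :
    ∫ x in (0 : ℝ)..1, exp (2 * Real.pi * I * (k * (x + z))) = if k = 0 then 1 else 0 := by
  have hsplit : ∀ x : ℝ, exp (2 * Real.pi * I * (k * (x + z)))
      = exp (2 * Real.pi * I * k * x) * exp (2 * Real.pi * I * k * z) := fun x => by
    rw [← exp_add]
    ring_nf
  split_ifs with h
  · simp [h]
  · simp only [hsplit]
    rw [intervalIntegral.integral_mul_const,
      integral_exp_mul_complex (by simp [h, Real.pi_ne_zero]), ofReal_one, mul_one,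
      mul_comm _ (k : ℂ), exp_int_mul_two_pi_mul_I]
    simp

theorem integral_integrand (n : ℕ) {y : ℝ} (hy : 0 < y) :
    ∫ x in (0 : ℝ)..1, integrand n (x + y * I) = p n := by
  set r : ℝ := Real.exp (-(2 * Real.pi * y)) with hr
  have hr1 : r < 1 := Real.exp_lt_one_iff.mpr (neg_lt_zero.mpr (mul_pos Real.two_pi_pos hy))
  have hnorm : ∀ (m : ℕ) (x : ℝ), ‖p m * exp (2 * Real.pi * I * ((m - n : ℤ) * (x + y * I)))‖
      = Real.exp (2 * Real.pi * y * n) * (p m * r ^ m) := fun m x => by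
    rw [norm_mul, norm_exp_two_pi_I_mul, Complex.norm_natCast, hr, ← Real.exp_nat_mul,
      mul_left_comm (Real.exp _), ← Real.exp_add]
    congr 2
    simp
    ring
  have hsum := intervalIntegral.hasSum_integral_of_dominated_convergence (a := 0) (b := 1)
    (μ := MeasureTheory.volume) (f := fun x : ℝ => integrand n (x + y * I))
    (F := fun (m : ℕ) (x : ℝ) => p m * exp (2 * Real.pi * I * ((m - n : ℤ) * (x + y * I))))
    (fun m _ => Real.exp (2 * Real.pi * y * n) * (p m * r ^ m))
    (fun m => Continuous.aestronglyMeasurable (by fun_prop))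
    (fun m => .of_forall fun x _ => (hnorm m x).le)
    (.of_forall fun x _ => (summable_p_mul_pow (Real.exp_pos _).le hr1).mul_left _)
    (by simp)
    (.of_forall fun x _ => hasSum_integrand n (by simpa using hy))
  refine hsum.unique ((hasSum_ite_eq n (p n : ℂ)).congr_fun fun m => ?_)
  rw [intervalIntegral.integral_const_mul, integral_exp_int_mul_add]
  by_cases h : m = n
  · simp [h]
  · simp [h, sub_eq_zero]

end Integrand

/-! ### The transformation behaviour at a cusp -/

section Cusp

open Complex Finset

theorem eta_eq (τ : ℂ) :
    ModularForm.eta τ = exp (2 * Real.pi * I * τ / 24) / partGen (exp (2 * Real.pi * I * τ)) := by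
  simp only [ModularForm.eta, partGen, div_inv_eq_mul, ModularForm.eta_q_eq_pow,
    Function.Periodic.qParam, ofReal_ofNat]

theorem integrand_eq_exp_div_eta (n : ℕ) (τ : ℂ) :
    integrand n τ = exp (-(2 * Real.pi * I * (n - 1 / 24) * τ)) / ModularForm.eta τ := by
  rw [eta_eq, integrand, div_div_eq_mul_div, mul_div_right_comm, ← exp_sub]
  congr 2
  ring

theorem etaMultiplier_spec (M : SL(2, ℤ)) (τ : ℍ) :
    ModularForm.eta ((M • τ : ℍ) : ℂ) = etaMultiplier M *
      csqrt ((M 1 0 : ℂ) * (τ : ℂ) + (M 1 1 : ℂ)) * ModularForm.eta (τ : ℂ) :=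
  (existsUnique_etaMultiplier M).choose_spec.1 τ

theorem norm_etaMultiplier (M : SL(2, ℤ)) : ‖etaMultiplier M‖ = 1 := by
  have hη := ModularForm.eta_ne_zero UpperHalfPlane.I.2
  have hd : (M 1 0 : ℂ) * (UpperHalfPlane.I : ℂ) + (M 1 1 : ℂ) ≠ 0 := by
    simpa [UpperHalfPlane.denom] using
      UpperHalfPlane.denom_ne_zero (M : GL (Fin 2) ℝ) UpperHalfPlane.I
  have hpow := eta_smul_pow M UpperHalfPlane.I
  rw [etaMultiplier_spec, mul_pow, mul_pow, show 24 = 2 * 12 from rfl, pow_mul (csqrt _),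
    csqrt_sq, ← show 24 = 2 * 12 from rfl] at hpow
  have h24 : etaMultiplier M ^ 24 = 1 := mul_right_cancel₀ (pow_ne_zero 12 hd)
    (by rw [mul_right_cancel₀ (pow_ne_zero 24 hη) hpow, one_mul])
  exact norm_eq_one_of_pow_eq_one h24 (by norm_num)

theorem log_I_div {z : ℂ} (hz : 0 < z.re) : log (I / z) = Real.pi / 2 * I - log z := by
  have hz0 : z ≠ 0 := fun h => by simp [h] at hz
  obtain ⟨hlow, hupp⟩ := abs_lt.mp (abs_arg_lt_pi_div_two_iff.mpr (Or.inl hz))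
  have him : (Real.pi / 2 * I - log z : ℂ).im = Real.pi / 2 - z.arg := by simp [log_im]
  have hexp : I / z = exp (Real.pi / 2 * I - log z) := by
    rw [exp_sub, exp_pi_div_two_mul_I, exp_log hz0]
  rw [hexp, log_exp (by rw [him]; linarith) (by rw [him]; linarith)]

theorem csqrt_I_div {z : ℂ} (hz : 0 < z.re) :
    csqrt (I / z) = exp (Real.pi * I / 4) * z ^ (-1 / 2 : ℂ) := by
  have hz0 : z ≠ 0 := fun h => by simp [h] at hz
  have harg : (I / z).arg ≠ Real.pi := by
    have him : (log (I / z)).im = Real.pi / 2 - z.arg := by simp [log_I_div hz, log_im]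
    rw [log_im] at him
    linarith [(abs_lt.mp (abs_arg_lt_pi_div_two_iff.mpr (Or.inl hz))).1, Real.pi_pos]
  rw [csqrt, if_neg harg, cpow_def_of_ne_zero (div_ne_zero I_ne_zero hz0),
    cpow_def_of_ne_zero hz0, log_I_div hz, ← exp_add]
  congr 1
  ring

theorem cpow_ofReal_mul {r : ℝ} (hr : 0 < r) {z : ℂ} (hz : z ≠ 0) (s : ℂ) :
    (r * z) ^ s = (r : ℂ) ^ s * z ^ s := by
  have hr0 : (r : ℂ) ≠ 0 := ofReal_ne_zero.mpr hr.ne'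
  rw [cpow_def_of_ne_zero (mul_ne_zero hr0 hz), cpow_def_of_ne_zero hr0, cpow_def_of_ne_zero hz,
    log_ofReal_mul hr hz, ← exp_add, ← add_mul, ofReal_log hr.le]

theorem im_ofReal_add_I_div_pos (x : ℝ) {c : ℝ} (hc : c ≠ 0) {w : ℂ} (hw : 0 < w.re) :
    0 < (x + I / (c ^ 2 * w) : ℂ).im := by
  have hw0 : w ≠ 0 := fun h => by simp [h] at hw
  have hsplit : I / (c ^ 2 * w) = ((1 / c ^ 2 : ℝ) : ℂ) * (I * w⁻¹) := by
    push_cast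
    field_simp
  rw [hsplit, add_im, ofReal_im, im_ofReal_mul, I_mul_im, inv_re, zero_add]
  have := normSq_pos.mpr hw0
  positivity

section Moebius

variable {M : SL(2, ℤ)} {τ : ℍ} {w : ℂ}

theorem mul_add_of_coe_eq (hM : M 1 0 ≠ 0) (hw : w ≠ 0)
    (hτ : (τ : ℂ) = -M 1 1 / M 1 0 + I / ((M 1 0 : ℂ) ^ 2 * w)) :
    (M 1 0 : ℂ) * τ + M 1 1 = I / (M 1 0 * w) := by
  have hc : (M 1 0 : ℂ) ≠ 0 := by exact_mod_cast hM
  rw [hτ]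
  field_simp
  ring

theorem coe_smul_of_coe_eq (hM : M 1 0 ≠ 0) (hw : w ≠ 0)
    (hτ : (τ : ℂ) = -M 1 1 / M 1 0 + I / ((M 1 0 : ℂ) ^ 2 * w)) :
    ((M • τ : ℍ) : ℂ) = M 0 0 / M 1 0 + I * w := by
  have hc : (M 1 0 : ℂ) ≠ 0 := by exact_mod_cast hM
  have hdet : (M 0 0 : ℂ) * M 1 1 - M 0 1 * M 1 0 = 1 := by
    have h := M.det_coe
    rw [Matrix.det_fin_two] at h
    exact_mod_cast h
  have hquot : ((M 0 0 : ℂ) * τ + M 0 1) / (M 1 0 * τ + M 1 1) = M 0 0 / M 1 0 + I * w := by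
    rw [mul_add_of_coe_eq hM hw hτ, div_eq_iff (div_ne_zero I_ne_zero (mul_ne_zero hc hw)), hτ]
    field_simp
    linear_combination (-(M 1 0 : ℂ) * w) * hdet - w * M 1 0 * I_sq
  rw [UpperHalfPlane.specialLinearGroup_apply]
  simpa using hquot

end Moebius

theorem matrixOfBottomRow_one {c d : ℤ} (h : Int.gcd d c = 1) :
    matrixOfBottomRow c d 1 0 = c ∧ matrixOfBottomRow c d 1 1 = d := by
  simp [matrixOfBottomRow, h]

/-- The summand of `A c n` belonging to the residue class of `d`, which is the coefficient with
which the cusp `-d / c` contributes to `p n`. -/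
def cuspCoeff (n c d : ℕ) : ℂ :=
  exp (Real.pi * I / 4) * (etaMultiplier (matrixOfBottomRow c d) *
    exp (2 * Real.pi * I *
      ((-1 / 24 * (matrixOfBottomRow c d 0 0 : ℂ) + (n - 1 / 24) * (d : ℂ)) / (c : ℂ))))

theorem A_eq_sum_cuspCoeff (c n : ℕ) :
    A c n = ∑ d ∈ (range c).filter (fun d => Nat.Coprime c d), cuspCoeff n c d := by
  rw [A, kloostermanSum, mul_sum]
  refine sum_congr rfl fun d _ => ?_
  rw [cuspCoeff]
  push_cast
  rw [show (-24 * (-1 / 24) : ℂ) = 1 by norm_num, cpow_one]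

theorem norm_cuspCoeff (n c d : ℕ) : ‖cuspCoeff n c d‖ = 1 := by
  have hexp : ∀ x : ℝ, ‖exp (2 * Real.pi * I * x)‖ = 1 := fun x => by
    rw [norm_exp_two_pi_I_mul]
    simp
  have heighth := hexp (1 / 8)
  have hroot :=
    hexp ((-1 / 24 * (matrixOfBottomRow c d 0 0 : ℝ) + (n - 1 / 24) * (d : ℝ)) / (c : ℝ))
  push_cast at heighth hroot
  rw [cuspCoeff, norm_mul, norm_mul, norm_etaMultiplier, hroot,
    show Real.pi * I / 4 = 2 * Real.pi * I * (1 / 8) by ring, heighth]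
  norm_num

theorem norm_A_le (c n : ℕ) : ‖A c n‖ ≤ c := by
  rw [A_eq_sum_cuspCoeff]
  refine (norm_sum_le _ _).trans ?_
  simp only [norm_cuspCoeff, sum_const, nsmul_eq_mul, mul_one]
  exact_mod_cast (card_filter_le _ _).trans (card_range c).le

theorem exp_neg_cusp_eq (n : ℕ) {a c d w : ℂ} (hc : c ≠ 0) (hw : w ≠ 0) :
    exp (-(2 * Real.pi * I * (n - 1 / 24) * (-d / c + I / (c ^ 2 * w)))) =
      exp (2 * Real.pi * I * ((-1 / 24 * a + (n - 1 / 24) * d) / c)) *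
      exp (Real.pi / 12 * w + 2 * Real.pi * (n - 1 / 24) / c ^ 2 / w) *
      exp (2 * Real.pi * I * (a / c + I * w) / 24) := by
  rw [← exp_add, ← exp_add]
  congr 1
  field_simp
  linear_combination (24 - 576 * n - 24 * c ^ 2 * w ^ 2 : ℂ) * I_sq

theorem integrand_cusp (n : ℕ) {c d : ℕ} (hc : 0 < c) (h : Nat.Coprime c d) {w : ℂ}
    (hw : 0 < w.re) :
    integrand n (-d / c + I / (c ^ 2 * w)) = cuspCoeff n c d * ((c : ℂ) ^ (-1 / 2 : ℂ) *
      w ^ (-1 / 2 : ℂ) * exp (Real.pi / 12 * w + 2 * Real.pi * (n - 1 / 24) / c ^ 2 / w)) *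
      partGen (exp (2 * Real.pi * I * ((matrixOfBottomRow c d 0 0 : ℂ) / c + I * w))) := by
  have hw0 : w ≠ 0 := fun h => by simp [h] at hw
  have hcR : (0 : ℝ) < c := by exact_mod_cast hc
  have hc0 : (c : ℂ) ≠ 0 := by exact_mod_cast hc.ne'
  obtain ⟨h10, h11⟩ := matrixOfBottomRow_one (c := c) (d := d)
    (by rw [Int.gcd_natCast_natCast]; exact h.symm)
  rw [cuspCoeff]
  set M := matrixOfBottomRow c d
  have him := im_ofReal_add_I_div_pos (-d / c) hcR.ne' hw
  push_cast at him
  obtain ⟨τ, hτ⟩ : ∃ τ : ℍ, (τ : ℂ) = -d / c + I / (c ^ 2 * w) := ⟨⟨_, him⟩, rfl⟩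
  have hτM : (τ : ℂ) = -M 1 1 / M 1 0 + I / ((M 1 0 : ℂ) ^ 2 * w) := by
    rw [h10, h11, hτ, Int.cast_natCast, Int.cast_natCast]
  have hM : M 1 0 ≠ 0 := by rw [h10]; exact_mod_cast hc.ne'
  have hcw : 0 < (c * w : ℂ).re := by
    rw [← ofReal_natCast, re_ofReal_mul]
    exact mul_pos hcR hw
  have hP : partGen (exp (2 * Real.pi * I * (M 0 0 / c + I * w))) ≠ 0 := by
    refine inv_ne_zero (tprod_one_sub_pow_ne_zero (norm_exp_two_pi_I_mul_lt_one ?_))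
    simpa using hw
  have hspec := etaMultiplier_spec M τ
  rw [mul_add_of_coe_eq hM hw0 hτM, coe_smul_of_coe_eq hM hw0 hτM, eta_eq, h10, Int.cast_natCast,
    csqrt_I_div hcw, div_eq_iff hP] at hspec
  rw [integrand_eq_exp_div_eta, exp_neg_cusp_eq n hc0 hw0, ← hτ,
    div_eq_iff (ModularForm.eta_ne_zero τ.2), hspec, ← ofReal_natCast c, cpow_ofReal_mul hcR hw0]
  ring

end Cusp

/-! ### The Farey dissection -/

section Farey

open Finset intervalIntegral

/-- The least non-negative residue of `ε l⁻¹` modulo `k`. The neighbours of `-h / k` with the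
denominator `l` in a Farey sequence are on its right for `h ≡ l⁻¹` and on its left for
`h ≡ -l⁻¹`, so that the sign `ε` stands for the side. -/
def invRes (ε : ℤˣ) (k l : ℕ) : ℕ := (((ε : ℤ) : ZMod k) * (l : ZMod k)⁻¹).val

theorem dvd_invRes (ε : ℤˣ) {k l : ℕ} (hk : 0 < k) (h : Nat.Coprime k l) :
    (k : ℤ) ∣ invRes ε k l * l - (ε : ℤ) := by
  have : NeZero k := ⟨hk.ne'⟩
  rw [← ZMod.intCast_zmod_eq_zero_iff_dvd]
  push_cast
  rw [invRes, ZMod.natCast_zmod_val, mul_right_comm, mul_assoc, ZMod.coe_mul_inv_eq_one _ h.symm,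
    mul_one, sub_self]

theorem coprime_invRes (ε : ℤˣ) {k l : ℕ} (hk : 0 < k) (h : Nat.Coprime k l) :
    Nat.Coprime k (invRes ε k l) := by
  rw [← Nat.isCoprime_iff_coprime]
  obtain ⟨t, ht⟩ := dvd_invRes ε hk h
  have hε : (ε : ℤ) * ε = 1 := Int.units_coe_mul_self ε
  exact ⟨-ε * t, ε * l, by linear_combination hε + ε * ht⟩

/-- The positive integers `l ≤ N`, prime to `k`, with `N < k + l`: the denominators of the right
neighbours of the fractions with denominator `k` in the Farey sequence of order `N`, and likewise
of the left neighbours. -/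
def fareyDenoms (N k : ℕ) : Finset ℕ := (Ioc (N - k) N).filter (Nat.Coprime k)

theorem card_fareyDenoms {N k : ℕ} (hkN : k ≤ N) : #(fareyDenoms N k) = Nat.totient k := by
  rw [← Nat.filter_coprime_Ico_eq_totient k (N - k + 1), fareyDenoms]
  congr 2
  ext x
  simp only [mem_Ioc, mem_Ico]
  omega

theorem injOn_invRes (ε : ℤˣ) {N k : ℕ} (hk : 0 < k) :
    Set.InjOn (invRes ε k) (fareyDenoms N k) := fun l hl l' hl' h => by
  rw [mem_coe, fareyDenoms, mem_filter, mem_Ioc] at hl hl'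
  have hdvd : (k : ℤ) ∣ invRes ε k l * (l - l') := by
    have := dvd_sub (dvd_invRes ε hk hl.2) (dvd_invRes ε hk hl'.2)
    rwa [← h, sub_sub_sub_cancel_right, ← mul_sub] at this
  have hll' : (k : ℤ) ∣ l - l' :=
    (Nat.isCoprime_iff_coprime.mpr (coprime_invRes ε hk hl.2)).dvd_of_dvd_mul_left hdvd
  have := Int.eq_zero_of_abs_lt_dvd hll' (by rw [abs_lt]; omega)
  omega

theorem sum_fareyDenoms_invRes {M : Type*} [AddCommMonoid M] (ε : ℤˣ) {N k : ℕ} (hk : 0 < k)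
    (hkN : k ≤ N) (g : ℕ → M) :
    ∑ l ∈ fareyDenoms N k, g (invRes ε k l) = ∑ d ∈ range k with Nat.Coprime k d, g d := by
  have : NeZero k := ⟨hk.ne'⟩
  have himage : (fareyDenoms N k).image (invRes ε k) = {d ∈ range k | Nat.Coprime k d} := by
    refine eq_of_subset_of_card_le (fun x hx => ?_) ?_
    · obtain ⟨l, hl, rfl⟩ := mem_image.mp hx
      exact mem_filter.mpr ⟨mem_range.mpr (ZMod.val_lt _),
        coprime_invRes ε hk (mem_filter.mp hl).2⟩
    · rw [card_image_of_injOn (injOn_invRes ε hk), card_fareyDenoms hkN,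
        Nat.totient_eq_card_coprime]
  rw [← himage, sum_image (injOn_invRes ε hk)]

theorem sum_fareyDenoms_eq_sum_ite {M : Type*} [AddCommMonoid M] {N k : ℕ} (hkN : k ≤ N)
    (g : ℕ → M) :
    ∑ l ∈ fareyDenoms N k, g l = ∑ l ∈ Icc 1 N, if N < k + l ∧ Nat.Coprime k l then g l else 0 := by
  rw [← sum_filter]
  congr 1
  ext l
  simp only [fareyDenoms, mem_filter, mem_Ioc, mem_Icc, ← and_assoc]
  exact and_congr_left fun _ => by omega

theorem sum_farey_pairs_succ {M : Type*} [AddCommGroup M] {h : ℕ → ℕ → M}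
    (hmed : ∀ b d, 0 < b → 0 < d → h b d = h b (b + d) + h (b + d) d)
    (hdiag : ∀ b, 1 < b → h b b = 0) {N : ℕ} (hN : 1 ≤ N) :
    ∑ b ∈ Icc 1 (N + 1), ∑ d ∈ Icc 1 (N + 1), (if N + 1 < b + d then h b d else 0)
      = ∑ b ∈ Icc 1 N, ∑ d ∈ Icc 1 N, (if N < b + d then h b d else 0) := by
  have hsplit (b : ℕ) (hb : b ∈ Icc 1 N) : ∑ d ∈ Icc 1 N, (if N < b + d then h b d else 0)
      = ∑ d ∈ Icc 1 N, (if N + 1 < b + d then h b d else 0)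
        + (h b (N + 1) + h (N + 1) (N + 1 - b)) := by
    rw [mem_Icc] at hb
    have hite (d : ℕ) : (if N < b + d then h b d else 0)
        = (if N + 1 < b + d then h b d else 0) + if N + 1 - b = d then h b d else 0 := by
      split_ifs <;> first | omega | simp
    simp only [hite]
    rw [sum_add_distrib, sum_ite_eq, if_pos (by rw [mem_Icc]; omega),
      hmed b (N + 1 - b) (by omega) (by omega), show b + (N + 1 - b) = N + 1 by omega]
  have hflip : ∑ b ∈ Icc 1 N, h (N + 1) (N + 1 - b) = ∑ d ∈ Icc 1 N, h (N + 1) d := by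
    refine sum_nbij' (fun b => N + 1 - b) (fun b => N + 1 - b) ?_ ?_ ?_ ?_ ?_ <;>
      simp only [mem_Icc] <;> intros <;> first | omega | trivial
  have hcol : ∑ b ∈ Icc 1 N, (if N + 1 < b + (N + 1) then h b (N + 1) else 0)
      = ∑ b ∈ Icc 1 N, h b (N + 1) :=
    sum_congr rfl fun b hb => if_pos (by rw [mem_Icc] at hb; omega)
  have hrow : ∑ d ∈ Icc 1 N, (if N + 1 < N + 1 + d then h (N + 1) d else 0)
      = ∑ d ∈ Icc 1 N, h (N + 1) d :=
    sum_congr rfl fun d hd => if_pos (by rw [mem_Icc] at hd; omega)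
  rw [sum_congr rfl hsplit, sum_Icc_succ_top (by omega)]
  simp only [sum_Icc_succ_top (show 1 ≤ N + 1 by omega), sum_add_distrib]
  rw [hflip, hcol, hrow, if_pos (by omega), hdiag _ (by omega), add_zero, add_assoc]

variable {E : Type*} [NormedAddCommGroup E] [NormedSpace ℝ E] {f : ℝ → E}

/-- The integral of `f` from the cusp `-invRes ε k l / k` to the mediant on its right (`ε = 1`), or
from the mediant on its left to the cusp (`ε = -1`). -/
def halfArc (f : ℝ → E) (ε : ℤˣ) (k l : ℕ) : E :=
  ∫ θ in (0 : ℝ)..1 / (k * (k + l)), f (-(invRes ε k l : ℝ) / k + ((ε : ℤ) : ℝ) * θ)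

/-- The integral of `f` over the interval between two neighbours, with the denominators
`b` and `d`, in a Farey sequence. The value is `0` if `b` and `d` are not coprime. -/
def fareyArc (f : ℝ → E) (b d : ℕ) : E :=
  if Nat.Coprime b d then ∫ θ in (0 : ℝ)..1 / (b * d), f (-(invRes 1 b d : ℝ) / b + θ) else 0

theorem apply_fareyNeighbour {α : Type*} {f : ℝ → α} (hf : Function.Periodic f 1) {b d : ℕ}
    (hb : 0 < b) (hd : 0 < d) (h : Nat.Coprime b d) {r s : ℕ} (hr : (b : ℤ) ∣ r * d - 1)
    (hs : (d : ℤ) ∣ s * b + 1) (θ : ℝ) :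
    f (-(s : ℝ) / d + θ) = f (-(r : ℝ) / b + (1 / (b * d) + θ)) := by
  obtain ⟨t, ht⟩ := hr
  obtain ⟨u, hu⟩ : (d : ℤ) ∣ s - t := by
    have : (d : ℤ) ∣ (s - t) * b := by
      rw [show ((s : ℤ) - t) * b = s * b + 1 - d * r by linear_combination ht]
      exact hs.sub (dvd_mul_right _ _)
    exact (Nat.isCoprime_iff_coprime.mpr h.symm).dvd_of_dvd_mul_right this
  have ht' : (r : ℝ) * d - 1 = b * t := by exact_mod_cast ht
  have hu' : (s : ℝ) - t = d * u := by exact_mod_cast hu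
  have hbR : (b : ℝ) ≠ 0 := by exact_mod_cast hb.ne'
  have hdR : (d : ℝ) ≠ 0 := by exact_mod_cast hd.ne'
  rw [← hf.int_mul u (-(s : ℝ) / d + θ)]
  congr 1
  field_simp
  linear_combination -(b : ℝ) * hu' + ht'

theorem fareyArc_eq_halfArc_add_halfArc (hf : Function.Periodic f 1) (hc : Continuous f) {b d : ℕ}
    (hb : 0 < b) (hd : 0 < d) (h : Nat.Coprime b d) :
    fareyArc f b d = halfArc f 1 b d + halfArc f (-1) d b := by
  have : (0 : ℝ) < b := by exact_mod_cast hb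
  have : (0 : ℝ) < d := by exact_mod_cast hd
  have hint (x y : ℝ) : IntervalIntegrable (fun θ => f (-(invRes 1 b d : ℝ) / b + θ))
      MeasureTheory.volume x y := (by fun_prop : Continuous _).intervalIntegrable _ _
  have hright := dvd_invRes 1 hb h
  have hleft := dvd_invRes (-1) hd h.symm
  rw [Units.val_one] at hright
  rw [Units.val_neg, Units.val_one, sub_neg_eq_add] at hleft
  rw [fareyArc, if_pos h, halfArc, halfArc,
    ← integral_add_adjacent_intervals (hint 0 (1 / (b * (b + d)))) (hint _ _)]
  simp only [Units.val_neg, Units.val_one, Int.cast_neg, Int.cast_one, one_mul, neg_mul]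
  simp only [apply_fareyNeighbour hf hb hd h hright hleft]
  simp only [← sub_eq_add_neg]
  rw [integral_comp_sub_left (fun θ => f (-(invRes 1 b d : ℝ) / b + θ))]
  congr 2
  · field_simp
    ring
  · ring

theorem fareyArc_mediant (hf : Function.Periodic f 1) (hc : Continuous f) {b d : ℕ}
    (hb : 0 < b) (hd : 0 < d) :
    fareyArc f b d = fareyArc f b (b + d) + fareyArc f (b + d) d := by
  by_cases h : Nat.Coprime b d
  swap
  · rw [fareyArc, if_neg h, fareyArc, if_neg (by simpa using h), fareyArc,
      if_neg (by simpa using h), add_zero]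
  have : (0 : ℝ) < b := by exact_mod_cast hb
  have : (0 : ℝ) < d := by exact_mod_cast hd
  have hleft : Nat.Coprime b (b + d) := by simpa using h
  have hright : Nat.Coprime (b + d) d := by simpa using h
  have hint (x y : ℝ) : IntervalIntegrable (fun θ => f (-(invRes 1 b d : ℝ) / b + θ))
      MeasureTheory.volume x y := (by fun_prop : Continuous _).intervalIntegrable _ _
  have hinv : invRes 1 b (b + d) = invRes 1 b d := by simp [invRes]
  have hr := dvd_invRes 1 hb hleft
  have hs : ((b + d : ℕ) : ℤ) ∣ invRes 1 (b + d) d * b + 1 := by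
    rw [show (invRes 1 (b + d) d * b + 1 : ℤ)
      = invRes 1 (b + d) d * (b + d : ℕ) - (invRes 1 (b + d) d * d - 1) by push_cast; ring]
    exact (dvd_mul_left _ _).sub (dvd_invRes 1 (by omega) hright)
  rw [fareyArc, if_pos h, fareyArc, if_pos hleft, fareyArc, if_pos hright]
  have hshift := apply_fareyNeighbour hf hb (by omega) hleft hr hs
  rw [hinv] at hshift ⊢
  push_cast at hshift ⊢
  simp only [hshift]
  rw [integral_comp_add_left (fun θ => f (-(invRes 1 b d : ℝ) / b + θ)),
    ← integral_add_adjacent_intervals (hint 0 (1 / (b * (b + d)))) (hint _ _)]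
  congr 2
  · rw [add_zero]
  · field_simp
    ring

theorem integral_eq_sum_fareyArc (hf : Function.Periodic f 1) (hc : Continuous f) {N : ℕ}
    (hN : 1 ≤ N) :
    ∫ x in (0 : ℝ)..1, f x
      = ∑ b ∈ Icc 1 N, ∑ d ∈ Icc 1 N, (if N < b + d then fareyArc f b d else 0) := by
  induction N, hN using Nat.le_induction with
  | base => simp [fareyArc, invRes, Subsingleton.elim _ (0 : ZMod 1)]
  | succ N hN ih =>
    rw [ih, sum_farey_pairs_succ (fun b d hb hd => fareyArc_mediant hf hc hb hd) _ hN]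
    intro b hb
    rw [fareyArc, if_neg]
    rw [Nat.coprime_self]
    omega

theorem integral_eq_sum_halfArc (hf : Function.Periodic f 1) (hc : Continuous f) {N : ℕ}
    (hN : 1 ≤ N) :
    ∫ x in (0 : ℝ)..1, f x
      = ∑ k ∈ Icc 1 N, ∑ l ∈ fareyDenoms N k, (halfArc f 1 k l + halfArc f (-1) k l) := by
  have hsplit (b : ℕ) (hb : b ∈ Icc 1 N) (d : ℕ) (hd : d ∈ Icc 1 N) :
      (if N < b + d then fareyArc f b d else 0)
      = (if N < b + d ∧ Nat.Coprime b d then halfArc f 1 b d else 0)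
        + if N < d + b ∧ Nat.Coprime d b then halfArc f (-1) d b else 0 := by
    rw [mem_Icc] at hb hd
    simp only [ite_and, add_comm d b, Nat.coprime_comm (n := d)]
    split_ifs with hlt hcop
    · exact fareyArc_eq_halfArc_add_halfArc hf hc (by omega) (by omega) hcop
    · rw [fareyArc, if_neg hcop, add_zero]
    · rw [add_zero]
  rw [integral_eq_sum_fareyArc hf hc hN, sum_congr rfl fun b hb => sum_congr rfl (hsplit b hb)]
  simp only [sum_add_distrib]
  rw [sum_comm (f := fun b d => if N < d + b ∧ Nat.Coprime d b then halfArc f (-1) d b else 0)]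
  congr 1 <;>
    exact sum_congr rfl fun k hk => (sum_fareyDenoms_eq_sum_ite (mem_Icc.mp hk).2 _).symm

end Farey

/-! ### The Bessel kernel in the right half plane -/

section BesselKernel

open Complex Filter MeasureTheory Set
open scoped Topology

/-- The function `w ^ (-s) * exp (a * w + b / w)`, whose integrals over vertical lines are values of
modified Bessel functions. -/
def besselKernel (s a b : ℝ) (w : ℂ) : ℂ := w ^ (-s : ℂ) * exp (a * w + b / w)

variable {s a b : ℝ}

theorem differentiableOn_besselKernel (s a b : ℝ) :
    DifferentiableOn ℂ (besselKernel s a b) {w | 0 < w.re} := by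
  intro w (hw : 0 < w.re)
  have hw0 : w ≠ 0 := by
    rintro rfl
    simp at hw
  have hpow : DifferentiableAt ℂ (fun w : ℂ => w ^ (-s : ℂ)) w :=
    differentiableAt_id.cpow (differentiableAt_const _) (Or.inl hw)
  have hexp : DifferentiableAt ℂ (fun w : ℂ => exp (a * w + b / w)) w := by
    fun_prop (disch := exact hw0)
  exact (hpow.mul hexp).differentiableWithinAt

theorem exists_primitive_besselKernel (s a b : ℝ) :
    ∃ Φ : ℂ → ℂ, ∀ w, 0 < w.re → HasDerivAt Φ (besselKernel s a b w) w := by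
  obtain ⟨Φ, hΦ⟩ := (convex_halfSpace_re_gt 0).exists_forall_hasDerivWithinAt
    (differentiableOn_besselKernel s a b)
  exact ⟨Φ, fun w hw =>
    (hΦ w hw).hasDerivAt ((isOpen_lt continuous_const continuous_re).mem_nhds hw)⟩

theorem norm_besselKernel_le (ha : 0 ≤ a) (hb : 0 ≤ b) {w : ℂ} (hw : w.re ∈ Icc (1 / 2) 4) :
    ‖besselKernel s a b w‖ ≤ Real.exp (4 * a + 2 * b) * ‖w‖ ^ (-s) := by
  have hre : (a * w + b / w : ℂ).re = a * w.re + b * (w⁻¹).re := by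
    rw [div_eq_mul_inv (b : ℂ), add_re, re_ofReal_mul, re_ofReal_mul]
  have hinv : (w⁻¹).re ≤ 2 := by
    have hnorm : 1 / 2 ≤ ‖w‖ := hw.1.trans (re_le_norm w)
    calc (w⁻¹).re ≤ ‖w‖⁻¹ := norm_inv w ▸ re_le_norm _
      _ ≤ (1 / 2)⁻¹ := by gcongr
      _ = 2 := by norm_num
  rw [besselKernel, norm_mul, ← ofReal_neg, norm_cpow_real, mul_comm, norm_exp, hre, mul_comm 4 a,
    mul_comm 2 b]
  gcongr
  exact hw.2

theorem norm_besselKernel_le_of_le_abs_im (hs : 0 ≤ s) (ha : 0 ≤ a) (hb : 0 ≤ b) {w : ℂ}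
    (hw : w.re ∈ Icc (1 / 2) 4) {t : ℝ} (ht : 0 < t) (htw : t ≤ |w.im|) :
    ‖besselKernel s a b w‖ ≤ Real.exp (4 * a + 2 * b) * t ^ (-s) := by
  refine (norm_besselKernel_le ha hb hw).trans ?_
  gcongr ?_ * ?_
  exact Real.rpow_le_rpow_of_nonpos ht (htw.trans (abs_im_le_norm w)) (by linarith)

theorem norm_besselKernel_le_of_re_eq_one (hs : 2 ≤ s) (ha : 0 ≤ a) (hb : 0 ≤ b) {w : ℂ}
    (hw : w.re = 1) :
    ‖besselKernel s a b w‖ ≤ Real.exp (4 * a + 2 * b) * (1 + w.im ^ 2)⁻¹ := by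
  have hone : 1 ≤ ‖w‖ := hw ▸ re_le_norm w
  have hsq : 1 + w.im ^ 2 = ‖w‖ ^ 2 := by rw [← normSq_eq_norm_sq, normSq_apply, hw]; ring
  refine (norm_besselKernel_le ha hb (by norm_num [hw])).trans ?_
  rw [hsq, ← Real.rpow_natCast, ← Real.rpow_neg (norm_nonneg w)]
  gcongr
  exact_mod_cast hs

theorem continuous_besselKernel_vertical (s a b : ℝ) {u : ℝ} (hu : 0 < u) (ε : ℤˣ) :
    Continuous fun t : ℝ => besselKernel s a b (u + (ε : ℤ) * t * I) :=
  (differentiableOn_besselKernel s a b).continuousOn.comp_continuous (by fun_prop)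
    fun t => by simpa using hu

theorem integrable_besselKernel_vertical (hs : 2 ≤ s) (ha : 0 ≤ a) (hb : 0 ≤ b) (ε : ℤˣ) :
    Integrable fun t : ℝ => besselKernel s a b ((1 : ℝ) + (ε : ℤ) * t * I) := by
  refine (integrable_inv_one_add_sq.const_mul (Real.exp (4 * a + 2 * b))).mono'
    (continuous_besselKernel_vertical s a b one_pos ε).aestronglyMeasurable (.of_forall fun t => ?_)
  refine (norm_besselKernel_le_of_re_eq_one hs ha hb (by simp)).trans_eq ?_
  obtain rfl | rfl := Int.units_eq_one_or ε <;> simp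

section Primitive

variable {Φ : ℂ → ℂ}

theorem hasDerivAt_primitive_vertical (hΦ : ∀ w, 0 < w.re → HasDerivAt Φ (besselKernel s a b w) w)
    {u : ℝ} (hu : 0 < u) (ε : ℤˣ) (t : ℝ) :
    HasDerivAt (fun t : ℝ => Φ (u + (ε : ℤ) * t * I))
      (besselKernel s a b (u + (ε : ℤ) * t * I) * ((ε : ℤ) * I)) t := by
  have hline : HasDerivAt (fun t : ℝ => (u + (ε : ℤ) * t * I : ℂ)) ((ε : ℤ) * I) t := by
    simpa using ((((hasDerivAt_id t).ofReal_comp).const_mul ((ε : ℤ) : ℂ)).mul_const I).const_add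
      (u : ℂ)
  exact (hΦ _ (by simpa using hu)).comp t hline

theorem integral_besselKernel_vertical
    (hΦ : ∀ w, 0 < w.re → HasDerivAt Φ (besselKernel s a b w) w) {u : ℝ} (hu : 0 < u) (ε : ℤˣ)
    (v T : ℝ) :
    ∫ t in v..T, besselKernel s a b (u + (ε : ℤ) * t * I) * ((ε : ℤ) * I)
      = Φ (u + (ε : ℤ) * T * I) - Φ (u + (ε : ℤ) * v * I) :=
  intervalIntegral.integral_eq_sub_of_hasDerivAt
    (fun t _ => hasDerivAt_primitive_vertical hΦ hu ε t)
    (((continuous_besselKernel_vertical s a b hu ε).mul_const _).intervalIntegrable _ _)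

theorem norm_unit_mul_I (ε : ℤˣ) : ‖((ε : ℤ) * I : ℂ)‖ = 1 := by
  obtain rfl | rfl := Int.units_eq_one_or ε <;> simp

theorem abs_im_add_unit_mul_I (ε : ℤˣ) (u : ℝ) {t : ℝ} (ht : 0 ≤ t) :
    |(u + (ε : ℤ) * t * I : ℂ).im| = t := by
  obtain rfl | rfl := Int.units_eq_one_or ε <;> simp [abs_of_nonneg ht]

theorem norm_primitive_sub_vertical_le (hs : 1 < s) (ha : 0 ≤ a) (hb : 0 ≤ b)
    (hΦ : ∀ w, 0 < w.re → HasDerivAt Φ (besselKernel s a b w) w) (ε : ℤˣ) {u v T : ℝ}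
    (hu : u ∈ Icc (1 / 2) 4) (hv : 0 < v) (hvT : v ≤ T) :
    ‖Φ (u + (ε : ℤ) * T * I) - Φ (u + (ε : ℤ) * v * I)‖
      ≤ Real.exp (4 * a + 2 * b) * (v ^ (1 - s) / (s - 1)) := by
  have hu0 : 0 < u := by linarith [hu.1]
  have hzero : (0 : ℝ) ∉ uIcc v T := by
    rw [uIcc_of_le hvT]
    exact fun h => hv.not_ge h.1
  rw [← integral_besselKernel_vertical hΦ hu0]
  calc ‖∫ t in v..T, besselKernel s a b (u + (ε : ℤ) * t * I) * ((ε : ℤ) * I)‖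
    _ ≤ ∫ t in v..T, Real.exp (4 * a + 2 * b) * t ^ (-s) := by
      refine intervalIntegral.norm_integral_le_of_norm_le hvT (.of_forall fun t ht => ?_)
        ((intervalIntegral.intervalIntegrable_rpow (Or.inr hzero)).const_mul _)
      have ht0 : 0 < t := hv.trans ht.1
      rw [norm_mul, norm_unit_mul_I, mul_one]
      exact norm_besselKernel_le_of_le_abs_im (by linarith) ha hb (by simpa using hu) ht0
        (abs_im_add_unit_mul_I ε u ht0.le).ge
    _ = Real.exp (4 * a + 2 * b) * ((v ^ (1 - s) - T ^ (1 - s)) / (s - 1)) := by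
      rw [intervalIntegral.integral_const_mul, integral_rpow (Or.inr ⟨by linarith, hzero⟩),
        neg_add_eq_sub, ← neg_sub (v ^ _), ← neg_sub s, neg_div_neg_eq]
    _ ≤ Real.exp (4 * a + 2 * b) * (v ^ (1 - s) / (s - 1)) := by
      have hT : 0 ≤ T ^ (1 - s) := Real.rpow_nonneg (hv.le.trans hvT) _
      gcongr
      all_goals linarith

theorem tendsto_primitive_sub_horizontal (hs : 0 < s) (ha : 0 ≤ a) (hb : 0 ≤ b)
    (hΦ : ∀ w, 0 < w.re → HasDerivAt Φ (besselKernel s a b w) w) (ε : ℤˣ) {u u' : ℝ}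
    (hu : u ∈ Icc (1 / 2) 4) (hu' : u' ∈ Icc (1 / 2) 4) :
    Tendsto (fun T : ℝ => Φ (u + (ε : ℤ) * T * I) - Φ (u' + (ε : ℤ) * T * I)) atTop (𝓝 0) := by
  have hdecay : Tendsto (fun T : ℝ => Real.exp (4 * a + 2 * b) * T ^ (-s) * |u - u'|)
      atTop (𝓝 0) := by
    simpa using ((tendsto_rpow_neg_atTop hs).const_mul (Real.exp (4 * a + 2 * b))).mul_const
      |u - u'|
  refine squeeze_zero_norm' ?_ hdecay
  filter_upwards [eventually_gt_atTop 0] with T hT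
  have hderiv : ∀ x ∈ Icc (1 / 2 : ℝ) 4, HasDerivWithinAt (fun x : ℝ => Φ (x + (ε : ℤ) * T * I))
      (besselKernel s a b (x + (ε : ℤ) * T * I)) (Icc (1 / 2) 4) x := fun x hx => by
    have hline : HasDerivAt (fun x : ℝ => (x + (ε : ℤ) * T * I : ℂ)) 1 x := by
      simpa using ((hasDerivAt_id x).ofReal_comp).add_const ((ε : ℤ) * T * I : ℂ)
    have hre : 0 < (x + (ε : ℤ) * T * I : ℂ).re := by
      simpa using lt_of_lt_of_le (by norm_num) hx.1
    exact (((hΦ _ hre).comp x hline).congr_deriv (mul_one _)).hasDerivWithinAt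
  exact (convex_Icc (1 / 2 : ℝ) 4).norm_image_sub_le_of_norm_hasDerivWithin_le hderiv
    (fun x hx => norm_besselKernel_le_of_le_abs_im hs.le ha hb (by simpa using hx) hT
      (abs_im_add_unit_mul_I ε x hT.le).ge) hu' hu

theorem norm_limit_sub_primitive_le (hs : 1 < s) (ha : 0 ≤ a) (hb : 0 ≤ b)
    (hΦ : ∀ w, 0 < w.re → HasDerivAt Φ (besselKernel s a b w) w) (ε : ℤˣ) {L : ℂ}
    (hL : Tendsto (fun T : ℝ => Φ ((1 : ℝ) + (ε : ℤ) * T * I)) atTop (𝓝 L)) {u v : ℝ}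
    (hu : u ∈ Icc (1 / 2) 4) (hv : 0 < v) :
    ‖L - Φ (u + (ε : ℤ) * v * I)‖ ≤ Real.exp (4 * a + 2 * b) * (v ^ (1 - s) / (s - 1)) := by
  have hlim : Tendsto (fun T : ℝ => Φ (u + (ε : ℤ) * T * I)) atTop (𝓝 L) := by
    simpa using (tendsto_primitive_sub_horizontal (by linarith) ha hb hΦ ε hu
      (by norm_num : (1 : ℝ) ∈ Icc (1 / 2) 4)).add hL
  refine le_of_tendsto (hlim.sub_const _).norm ?_
  filter_upwards [eventually_ge_atTop v] with T hT
  exact norm_primitive_sub_vertical_le hs ha hb hΦ ε hu hv hT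

theorem tendsto_primitive_vertical (hs : 2 ≤ s) (ha : 0 ≤ a) (hb : 0 ≤ b)
    (hΦ : ∀ w, 0 < w.re → HasDerivAt Φ (besselKernel s a b w) w) (ε : ℤˣ) :
    Tendsto (fun T : ℝ => Φ ((1 : ℝ) + (ε : ℤ) * T * I)) atTop
      (𝓝 (Φ 1 + (∫ t in Ioi (0 : ℝ), besselKernel s a b ((1 : ℝ) + (ε : ℤ) * t * I))
        * ((ε : ℤ) * I))) := by
  have hint := intervalIntegral_tendsto_integral_Ioi 0
    (integrable_besselKernel_vertical hs ha hb ε).integrableOn tendsto_id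
  refine ((hint.mul_const (((ε : ℤ) : ℂ) * I)).const_add (Φ 1)).congr fun T => ?_
  rw [← intervalIntegral.integral_mul_const, integral_besselKernel_vertical hΦ one_pos]
  simp

end Primitive

/-- The integral of `besselKernel s a b` along the line `re w = 1`, with respect to `im w`. -/
def lineIntegral (s a b : ℝ) : ℂ := ∫ t : ℝ, besselKernel s a b (1 + t * I)

theorem norm_lineIntegral_le (hs : 2 ≤ s) (ha : 0 ≤ a) (hb : 0 ≤ b) :
    ‖lineIntegral s a b‖ ≤ Real.exp (4 * a + 2 * b) * Real.pi := by
  rw [← integral_univ_inv_one_add_sq, ← integral_const_mul]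
  refine norm_integral_le_of_norm_le (integrable_inv_one_add_sq.const_mul _)
    (.of_forall fun t => ?_)
  simpa using norm_besselKernel_le_of_re_eq_one (w := 1 + t * I) hs ha hb (by simp)

theorem lineIntegral_eq_add_integral_Ioi (hs : 2 ≤ s) (ha : 0 ≤ a) (hb : 0 ≤ b) :
    lineIntegral s a b = (∫ t in Ioi (0 : ℝ), besselKernel s a b (1 + t * I))
      + ∫ t in Ioi (0 : ℝ), besselKernel s a b (1 - t * I) := by
  have hint : Integrable fun t : ℝ => besselKernel s a b (1 + t * I) := by
    simpa using integrable_besselKernel_vertical hs ha hb 1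
  have hneg := integral_comp_neg_Ioi 0 fun t : ℝ => besselKernel s a b (1 + t * I)
  simp only [ofReal_neg, neg_mul, ← sub_eq_add_neg, neg_zero] at hneg
  rw [hneg, add_comm, intervalIntegral.integral_Iic_add_Ioi hint.integrableOn hint.integrableOn,
    lineIntegral]

theorem exists_primitive_besselKernel_limits (hs : 2 ≤ s) (ha : 0 ≤ a) (hb : 0 ≤ b) :
    ∃ (Φ : ℂ → ℂ) (L : ℤˣ → ℂ), (∀ w, 0 < w.re → HasDerivAt Φ (besselKernel s a b w) w) ∧
      L 1 - L (-1) = I * lineIntegral s a b ∧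
      ∀ (ε : ℤˣ) (u v : ℝ), u ∈ Icc (1 / 2) 4 → 0 < v →
        ‖L ε - Φ (u + (ε : ℤ) * v * I)‖
          ≤ Real.exp (4 * a + 2 * b) * (v ^ (1 - s) / (s - 1)) := by
  obtain ⟨Φ, hΦ⟩ := exists_primitive_besselKernel s a b
  refine ⟨Φ, fun ε => Φ 1 + (∫ t in Ioi (0 : ℝ), besselKernel s a b ((1 : ℝ) + (ε : ℤ) * t * I))
    * ((ε : ℤ) * I), hΦ, ?_, fun ε u v hu hv => ?_⟩
  · rw [lineIntegral_eq_add_integral_Ioi hs ha hb]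
    simp only [Units.val_one, Units.val_neg, Int.cast_one, Int.cast_neg, ofReal_one, one_mul,
      neg_mul, ← sub_eq_add_neg]
    ring
  · exact norm_limit_sub_primitive_le (by linarith) ha hb hΦ ε
      (tendsto_primitive_vertical hs ha hb hΦ ε) hu hv

end BesselKernel

/-! ### Evaluation of the line integral -/

section LaplaceTransform

open Complex Filter MeasureTheory Set
open scoped Topology

theorem norm_cpow_sub_one_mul_exp_neg {t : ℝ} (ht : 0 < t) (s r : ℂ) :
    ‖(t : ℂ) ^ (s - 1) * exp (-(r * t))‖ = t ^ (s.re - 1) * Real.exp (-(r.re * t)) := by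
  rw [norm_mul, norm_cpow_eq_rpow_re_of_pos ht, norm_exp]
  simp

theorem integrableOn_rpow_mul_exp_neg_mul {σ b : ℝ} (hσ : -1 < σ) (hb : 0 < b) :
    IntegrableOn (fun t : ℝ => t ^ σ * Real.exp (-(b * t))) (Ioi 0) := by
  simpa using integrableOn_rpow_mul_exp_neg_mul_rpow hσ one_pos hb

theorem aestronglyMeasurable_cpow_mul_exp_neg_mul (s r : ℂ) :
    AEStronglyMeasurable (fun t : ℝ => (t : ℂ) ^ (s - 1) * exp (-(r * t)))
      (volume.restrict (Ioi 0)) :=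
  Measurable.aestronglyMeasurable (by fun_prop)

theorem integrableOn_cpow_mul_exp_neg_mul {s r : ℂ} (hs : 0 < s.re) (hr : 0 < r.re) :
    IntegrableOn (fun t : ℝ => (t : ℂ) ^ (s - 1) * exp (-(r * t))) (Ioi 0) := by
  refine (integrableOn_rpow_mul_exp_neg_mul (by linarith : -1 < s.re - 1) hr).mono'
    (aestronglyMeasurable_cpow_mul_exp_neg_mul s r) ?_
  filter_upwards [ae_restrict_mem measurableSet_Ioi] with t ht
  exact (norm_cpow_sub_one_mul_exp_neg ht s r).le

theorem differentiableOn_integral_cpow_mul_exp_neg_mul {s : ℂ} (hs : 0 < s.re) :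
    DifferentiableOn ℂ (fun r : ℂ => ∫ t in Ioi (0 : ℝ), (t : ℂ) ^ (s - 1) * exp (-(r * t)))
      {r | 0 < r.re} := by
  intro r (hr : 0 < r.re)
  have hnhds : {z : ℂ | r.re / 2 < z.re} ∈ 𝓝 r :=
    (isOpen_lt continuous_const continuous_re).mem_nhds (half_lt_self hr)
  refine (hasDerivAt_integral_of_dominated_loc_of_deriv_le
    (F := fun (r : ℂ) (t : ℝ) => (t : ℂ) ^ (s - 1) * exp (-(r * t)))
    (F' := fun (r : ℂ) (t : ℝ) => (t : ℂ) ^ (s - 1) * (exp (-(r * t)) * (-t)))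
    (bound := fun t => t ^ s.re * Real.exp (-(r.re / 2 * t))) hnhds
    (.of_forall fun z => aestronglyMeasurable_cpow_mul_exp_neg_mul s z)
    (integrableOn_cpow_mul_exp_neg_mul hs hr) (Measurable.aestronglyMeasurable (by fun_prop)) ?_
    (integrableOn_rpow_mul_exp_neg_mul (by linarith) (half_pos hr))
    (.of_forall fun t z _ => ?_)).2.differentiableAt.differentiableWithinAt
  · filter_upwards [ae_restrict_mem measurableSet_Ioi] with t (ht : 0 < t) z (hz : r.re / 2 < z.re)
    calc ‖(t : ℂ) ^ (s - 1) * (exp (-(z * t)) * -t)‖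
      _ = t ^ (s.re - 1) * t * Real.exp (-(z.re * t)) := by
        rw [← mul_assoc, norm_mul, norm_cpow_sub_one_mul_exp_neg ht, norm_neg, norm_real,
          Real.norm_of_nonneg ht.le, mul_right_comm]
      _ = t ^ s.re * Real.exp (-(z.re * t)) := by
        rw [← Real.rpow_add_one ht.ne', sub_add_cancel]
      _ ≤ t ^ s.re * Real.exp (-(r.re / 2 * t)) := by gcongr
  · simpa using (((hasDerivAt_id z).mul_const (t : ℂ)).neg.cexp.const_mul _)

theorem integral_cpow_mul_exp_neg_mul_Ioi_of_re_pos {s r : ℂ} (hs : 0 < s.re) (hr : 0 < r.re) :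
    ∫ t in Ioi (0 : ℝ), (t : ℂ) ^ (s - 1) * exp (-(r * t)) = r ^ (-s) * Gamma s := by
  have hopen : IsOpen {r : ℂ | 0 < r.re} := isOpen_lt continuous_const continuous_re
  have hpow : DifferentiableOn ℂ (fun r : ℂ => r ^ (-s) * Gamma s) {r | 0 < r.re} :=
    fun z hz => ((differentiableAt_id.cpow (differentiableAt_const _)
      (Or.inl hz)).mul_const _).differentiableWithinAt
  have hreal : ∀ x : ℝ, 0 < x → ∫ t in Ioi (0 : ℝ), (t : ℂ) ^ (s - 1) * exp (-(x * t))
      = (x : ℂ) ^ (-s) * Gamma s := fun x hx => by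
    rw [integral_cpow_mul_exp_neg_mul_Ioi hs hx, one_div,
      inv_cpow _ _ (by rw [arg_ofReal_of_nonneg hx.le]; exact Real.pi_pos.ne), ← cpow_neg]
  have hofReal : Tendsto (fun x : ℝ => (x : ℂ)) (𝓝[≠] 1) (𝓝[≠] 1) := by
    simpa using (hasDerivAt_id (1 : ℝ)).ofReal_comp.tendsto_nhdsNE one_ne_zero
  refine ((differentiableOn_integral_cpow_mul_exp_neg_mul hs).analyticOnNhd hopen
    ).eqOn_of_preconnected_of_frequently_eq (hpow.analyticOnNhd hopen)
    (convex_halfSpace_re_gt 0).isPreconnected (z₀ := 1) (by simp) ?_ hr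
  refine hofReal.frequently (Eventually.frequently ?_)
  filter_upwards [eventually_nhdsWithin_of_eventually_nhds (lt_mem_nhds one_pos)] with x hx
  exact hreal x hx

end LaplaceTransform

section LineIntegral

open Complex MeasureTheory Set ProbabilityTheory
open scoped FourierTransform

variable {s a b : ℝ}

theorem integrable_gammaPDFReal {s r : ℝ} (hs : 0 < s) (hr : 0 < r) :
    Integrable (gammaPDFReal s r) := by
  refine (lintegral_ofReal_ne_top_iff_integrable
    (measurable_gammaPDFReal s r).aestronglyMeasurable
    (.of_forall (gammaPDFReal_nonneg hs hr))).mp ?_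
  exact (lintegral_gammaPDF_eq_one hs hr).trans_ne ENNReal.one_ne_top

theorem continuousAt_gammaPDFReal (s r : ℝ) {x : ℝ} (hx : 0 < x) :
    ContinuousAt (gammaPDFReal s r) x := by
  have hpow : ContinuousAt (fun t : ℝ => r ^ s / Real.Gamma s * t ^ (s - 1) * Real.exp (-(r * t)))
      x := by
    fun_prop (disch := exact Or.inl hx.ne')
  refine hpow.congr ?_
  filter_upwards [lt_mem_nhds hx] with t ht
  exact (if_pos ht.le).symm

theorem fourier_gammaPDFReal (hs : 0 < s) (ξ : ℝ) :
    𝓕 (fun t => (gammaPDFReal s 1 t : ℂ)) ξ = (1 + (2 * Real.pi * ξ : ℝ) * I) ^ (-s : ℂ) := by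
  have hΓ : Gamma s ≠ 0 := Gamma_ne_zero_of_re_pos (by simpa using hs)
  rw [Real.fourier_real_eq_integral_exp_smul,
    eq_div_of_mul_eq hΓ (integral_cpow_mul_exp_neg_mul_Ioi_of_re_pos (s := s)
      (r := 1 + (2 * Real.pi * ξ : ℝ) * I) (by simpa using hs) (by simp)).symm, ← integral_div,
    ← integral_Ici_eq_integral_Ioi, ← integral_indicator measurableSet_Ici]
  refine integral_congr_ae (.of_forall fun t => ?_)
  by_cases ht : 0 ≤ t
  · simp only [indicator_of_mem (mem_Ici.mpr ht), gammaPDFReal, if_pos ht, Real.one_rpow,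
      smul_eq_mul, ← ofReal_one, ← ofReal_sub, ← ofReal_cpow ht, Gamma_ofReal]
    rw [show -(((1 : ℝ) + (2 * Real.pi * ξ : ℝ) * I) * t)
      = (-2 * Real.pi * t * ξ : ℝ) * I + ((-(1 * t) : ℝ) : ℂ) by push_cast; ring, exp_add]
    push_cast
    ring
  · simp only [indicator_of_notMem (mt mem_Ici.mp ht), gammaPDFReal, if_neg ht, ofReal_zero,
      smul_zero]

theorem integral_exp_mul_cpow_line (hs : 2 ≤ s) (ha : 0 < a) :
    ∫ t : ℝ, exp (a * t * I) * (1 + t * I) ^ (-s : ℂ) = 2 * Real.pi * gammaPDFReal s 1 a := by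
  have hs0 : 0 < s := by linarith
  have hint : Integrable (𝓕 fun t => (gammaPDFReal s 1 t : ℂ)) := by
    have hline : Integrable fun t : ℝ => (1 + t * I : ℂ) ^ (-s : ℂ) := by
      simpa [besselKernel] using integrable_besselKernel_vertical hs le_rfl le_rfl 1
    rw [funext (fourier_gammaPDFReal hs0)]
    exact hline.comp_mul_left' Real.two_pi_pos.ne'
  have hinv := (integrable_gammaPDFReal hs0 one_pos).ofReal.fourierInv_fourier_eq hint
    (continuous_ofReal.continuousAt.comp (continuousAt_gammaPDFReal s 1 ha))
  have hscale := Measure.integral_comp_mul_left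
    (fun t : ℝ => exp (a * t * I) * (1 + t * I) ^ (-s : ℂ)) (2 * Real.pi)
  have hπ : (2 * Real.pi : ℂ) ≠ 0 := by exact_mod_cast Real.two_pi_pos.ne'
  rw [abs_of_pos (inv_pos.mpr Real.two_pi_pos), real_smul, ofReal_inv, ofReal_mul, ofReal_ofNat,
    eq_inv_mul_iff_mul_eq₀ hπ] at hscale
  rw [← hscale, ← hinv, Real.fourierInv_eq']
  congr 2 with t
  rw [smul_eq_mul, fourier_gammaPDFReal hs0, RCLike.inner_apply, conj_trivial]
  push_cast
  ring_nf

theorem lineIntegral_zero (hs : 2 ≤ s) (ha : 0 < a) :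
    lineIntegral s a 0 = ((2 * Real.pi * a ^ (s - 1) / Real.Gamma s : ℝ) : ℂ) := by
  have hkernel : ∀ t : ℝ, besselKernel s a 0 (1 + t * I)
      = exp a * (exp (a * t * I) * (1 + t * I) ^ (-s : ℂ)) := fun t => by
    rw [besselKernel, ofReal_zero, zero_div, add_zero, mul_one_add, exp_add, ← mul_assoc (a : ℂ)]
    ring
  simp only [lineIntegral, hkernel]
  rw [integral_const_mul, integral_exp_mul_cpow_line hs ha, gammaPDFReal, if_pos ha.le,
    Real.one_rpow, one_mul, Real.exp_neg]
  have hexp : exp (a : ℂ) ≠ 0 := exp_ne_zero _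
  push_cast
  field_simp

theorem hasSum_besselKernel (s a b : ℝ) {w : ℂ} (hw : w ≠ 0) :
    HasSum (fun j : ℕ => ((b ^ j / j.factorial : ℝ) : ℂ) * besselKernel (s + j) a 0 w)
      (besselKernel s a b w) := by
  have hexp := (NormedSpace.expSeries_div_hasSum_exp (𝔸 := ℂ) (b / w)).mul_left
    (w ^ (-s : ℂ) * exp (a * w))
  rw [← exp_eq_exp_ℂ, mul_assoc, ← exp_add, ← besselKernel] at hexp
  refine hexp.congr_fun fun j => ?_
  rw [besselKernel, ofReal_add, ofReal_natCast, neg_add', cpow_sub _ _ hw, cpow_natCast]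
  push_cast
  rw [div_pow, zero_div, add_zero]
  ring

theorem hasSum_lineIntegral (hs : 2 ≤ s) (ha : 0 ≤ a) (hb : 0 ≤ b) :
    HasSum (fun j : ℕ => ((b ^ j / j.factorial : ℝ) : ℂ) * lineIntegral (s + j) a 0)
      (lineIntegral s a b) := by
  have hsum : Summable fun j : ℕ => b ^ j / j.factorial := Real.summable_pow_div_factorial b
  have hre : ∀ t : ℝ, (1 + t * I : ℂ).re = 1 := by simp
  simp only [lineIntegral, ← integral_const_mul]
  refine hasSum_integral_of_dominated_convergence
    (fun j t => b ^ j / j.factorial * (Real.exp (4 * a) * (1 + t ^ 2)⁻¹)) (fun j => ?_)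
    (fun j => .of_forall fun t => ?_) (.of_forall fun t => hsum.mul_right _) ?_
    (.of_forall fun t => hasSum_besselKernel s a b fun h => by simpa [h] using hre t)
  · simpa using ((continuous_besselKernel_vertical (s + j) a 0 one_pos 1).const_mul
      (((b ^ j / j.factorial : ℝ) : ℂ))).aestronglyMeasurable
  · rw [norm_mul, norm_real, Real.norm_of_nonneg (by positivity)]
    gcongr
    simpa using norm_besselKernel_le_of_re_eq_one (s := s + j) (b := 0)
      (le_add_of_le_of_nonneg hs j.cast_nonneg) ha le_rfl (hre t)
  · simp only [tsum_mul_right]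
    exact (integrable_inv_one_add_sq.const_mul _).const_mul _

theorem factorial_mul_Gamma_five_halves_add (j : ℕ) :
    j.factorial * Real.Gamma (5 / 2 + j)
      = Real.sqrt Real.pi * (2 * j + 3).factorial / ((j + 1) * 2 ^ (2 * j + 3)) := by
  have hdup := Real.Gamma_mul_Gamma_add_half (j + 2)
  rw [show (j + 2 + 1 / 2 : ℝ) = 5 / 2 + j by ring,
    show (j + 2 : ℝ) = (j + 1 : ℕ) + 1 by push_cast; ring, Real.Gamma_nat_eq_factorial,
    show (2 * ((j + 1 : ℕ) + 1) : ℝ) = (2 * j + 3 : ℕ) + 1 by push_cast; ring,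
    Real.Gamma_nat_eq_factorial, sub_add_cancel_right, Real.rpow_neg two_pos.le, Real.rpow_natCast,
    Nat.factorial_succ] at hdup
  push_cast at hdup
  field_simp at hdup ⊢
  linear_combination hdup

theorem hasDerivAt_sinh_mul_sqrt_div_sqrt (κ : ℝ) {y : ℝ} (hy : 0 < y) :
    HasDerivAt (fun y : ℝ => Real.sinh (κ * Real.sqrt y) / Real.sqrt y)
      ((κ * Real.sqrt y * Real.cosh (κ * Real.sqrt y) - Real.sinh (κ * Real.sqrt y))
        / (2 * Real.sqrt y ^ 3)) y := by
  have hsqrt : HasDerivAt Real.sqrt (1 / (2 * Real.sqrt y)) y := Real.hasDerivAt_sqrt hy.ne'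
  have hne : Real.sqrt y ≠ 0 := (Real.sqrt_pos.mpr hy).ne'
  refine ((hsqrt.const_mul κ).sinh.div hsqrt hne).congr_deriv ?_
  field_simp

theorem hasSum_mul_cosh_sub_sinh (z : ℝ) :
    HasSum (fun j : ℕ => 2 * z ^ (2 * j + 3) * ((j + 1) / (2 * j + 3).factorial))
      (z * Real.cosh z - Real.sinh z) := by
  have hsum := (hasSum_nat_add_iff' 1).mpr
    (((Real.hasSum_cosh z).mul_left z).sub (Real.hasSum_sinh z))
  simp only [Finset.sum_range_one, mul_zero, pow_zero, Nat.factorial_zero, zero_add, pow_one,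
    Nat.factorial_one, Nat.cast_one, div_one, mul_one, sub_self, sub_zero] at hsum
  refine hsum.congr_fun fun j => ?_
  rw [show 2 * (j + 1) + 1 = 2 * j + 2 + 1 by ring, show 2 * (j + 1) = 2 * j + 2 by ring,
    show 2 * j + 3 = 2 * j + 2 + 1 by ring, Nat.factorial_succ (2 * j + 2)]
  push_cast
  field_simp
  ring

theorem hasSum_deriv_sinh_mul_sqrt_div_sqrt (κ : ℝ) {y : ℝ} (hy : 0 < y) :
    HasSum (fun j : ℕ => κ ^ (2 * j + 3) * y ^ j * ((j + 1) / (2 * j + 3).factorial))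
      (deriv (fun y : ℝ => Real.sinh (κ * Real.sqrt y) / Real.sqrt y) y) := by
  have : 0 < Real.sqrt y := Real.sqrt_pos.mpr hy
  rw [(hasDerivAt_sinh_mul_sqrt_div_sqrt κ hy).deriv]
  refine ((hasSum_mul_cosh_sub_sinh (κ * Real.sqrt y)).div_const _).congr_fun fun j => ?_
  nth_rw 1 [← Real.sq_sqrt hy.le]
  field_simp
  ring

theorem lineIntegral_five_halves {κ y : ℝ} (ha : 0 < a) (hκ : 0 < κ) (hy : 0 < y) :
    lineIntegral (5 / 2) a (κ ^ 2 * y / (4 * a))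
      = ((16 * Real.sqrt Real.pi * a ^ (3 / 2 : ℝ) / κ ^ 3 *
          deriv (fun y : ℝ => Real.sinh (κ * Real.sqrt y) / Real.sqrt y) y : ℝ) : ℂ) := by
  refine (hasSum_lineIntegral (by norm_num) ha.le (by positivity)).unique
    ((hasSum_ofReal.mpr ((hasSum_deriv_sinh_mul_sqrt_div_sqrt κ hy).mul_left _)).congr_fun
      fun j => ?_)
  have hπ : Real.sqrt Real.pi ^ 2 = Real.pi := Real.sq_sqrt Real.pi_pos.le
  have hpow : (κ ^ 2 * y / (4 * a)) ^ j * a ^ j * 2 ^ (2 * j + 3) = 8 * κ ^ (2 * j) * y ^ j := by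
    have hbase : κ ^ 2 * y / (4 * a) * a * 2 ^ 2 = κ ^ 2 * y := by
      field_simp
      norm_num
    rw [pow_add, pow_mul 2, ← mul_assoc, ← mul_pow, ← mul_pow, hbase]
    ring
  rw [lineIntegral_zero (le_add_of_le_of_nonneg (by norm_num) j.cast_nonneg) ha, ← ofReal_mul,
    show (5 / 2 + j - 1 : ℝ) = 3 / 2 + j by ring, Real.rpow_add_natCast ha.ne',
    div_mul_div_comm, factorial_mul_Gamma_five_halves_add]
  congr 1
  rw [pow_add κ]
  field_simp
  rw [hπ]
  linear_combination 2 * Real.pi * hpow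

theorem mu_pos : 0 < mu := by
  unfold mu
  positivity

theorem mu_sq : mu ^ 2 = 2 * Real.pi ^ 2 / 3 := by
  rw [mu, mul_pow, Real.sq_sqrt (by norm_num)]
  ring

theorem sqrt_two_mul_sqrt_pi_mul_sqrt_pi_div_twelve :
    Real.sqrt 2 * Real.sqrt Real.pi * Real.sqrt (Real.pi / 12) = mu / 2 := by
  rw [← Real.sqrt_mul two_pos.le, ← Real.sqrt_mul (by positivity),
    Real.sqrt_eq_iff_mul_self_eq (by positivity) (half_pos mu_pos).le]
  linear_combination -mu_sq / 4

theorem rpow_mul_lineIntegral_eq_deriv {c : ℕ} (hc : 0 < c) {x : ℝ} (hx : 1 / 24 < x) :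
    (((c : ℝ) ^ (-5 / 2 : ℝ) : ℝ) : ℂ) *
        lineIntegral (5 / 2) (Real.pi / 12) (2 * Real.pi * (x - 1 / 24) / c ^ 2)
      = ((1 / (Real.pi * Real.sqrt 2) * (Real.sqrt c *
          deriv (fun x : ℝ => Real.sinh (mu * Real.sqrt (x - 1 / 24) / c) /
            Real.sqrt (x - 1 / 24)) x) : ℝ) : ℂ) := by
  have hcR : (0 : ℝ) < c := by exact_mod_cast hc
  have hmu := mu_pos
  have hderiv : deriv (fun x : ℝ => Real.sinh (mu * Real.sqrt (x - 1 / 24) / c) /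
      Real.sqrt (x - 1 / 24)) x
      = deriv (fun y : ℝ => Real.sinh (mu / c * Real.sqrt y) / Real.sqrt y) (x - 1 / 24) := by
    simp only [mul_div_right_comm mu]
    exact deriv_comp_sub_const (fun y : ℝ => Real.sinh (mu / c * Real.sqrt y) / Real.sqrt y) _ _
  have hb : 2 * Real.pi * (x - 1 / 24) / c ^ 2
      = (mu / c) ^ 2 * (x - 1 / 24) / (4 * (Real.pi / 12)) := by
    rw [div_pow, mu_sq]
    field_simp
    ring
  rw [hderiv, hb, lineIntegral_five_halves (by positivity) (by positivity) (by linarith),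
    ← ofReal_mul]
  congr 1
  have hrpow_c : (c : ℝ) ^ (-5 / 2 : ℝ) = Real.sqrt c / c ^ 3 := by
    rw [Real.sqrt_eq_rpow, ← Real.rpow_sub_natCast hcR.ne']
    norm_num
  have hrpow_π : (Real.pi / 12 : ℝ) ^ (3 / 2 : ℝ) = Real.pi / 12 * Real.sqrt (Real.pi / 12) := by
    rw [Real.sqrt_eq_rpow, ← Real.rpow_one_add' (by positivity) (by norm_num)]
    norm_num
  rw [hrpow_c, hrpow_π]
  generalize deriv (fun y : ℝ => Real.sinh (mu / c * Real.sqrt y) / Real.sqrt y) (x - 1 / 24) = D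
  field_simp
  linear_combination 16 * Real.pi ^ 2 * D * sqrt_two_mul_sqrt_pi_mul_sqrt_pi_div_twelve
    - 12 * mu * D * mu_sq

end LineIntegral

/-! ### The contribution of a Farey arc -/

section CuspCoordinate

open Complex

variable {k : ℕ} {y : ℝ}

/-- The coordinate `w` near a cusp with denominator `k` for which the point at height `y` and
horizontal distance `θ` from the cusp lies at `i / (k ^ 2 w)` relative to it. -/
def cuspCoord (k : ℕ) (y θ : ℝ) : ℂ := (k ^ 2 * (y - θ * I))⁻¹

theorem cuspCoord_eq (k : ℕ) (y θ : ℝ) :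
    cuspCoord k y θ = ((k ^ 2 * (y ^ 2 + θ ^ 2))⁻¹ : ℝ) * (y + θ * I) := by
  rw [cuspCoord, mul_inv, inv_def (y - θ * I : ℂ), mul_inv, ofReal_mul, mul_assoc]
  simp [normSq_apply, sq, mul_comm]

theorem cuspCoord_re (k : ℕ) (y θ : ℝ) :
    (cuspCoord k y θ).re = y / (k ^ 2 * (y ^ 2 + θ ^ 2)) := by
  rw [cuspCoord_eq, re_ofReal_mul]
  simp [div_eq_inv_mul]

theorem cuspCoord_im (k : ℕ) (y θ : ℝ) :
    (cuspCoord k y θ).im = θ / (k ^ 2 * (y ^ 2 + θ ^ 2)) := by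
  rw [cuspCoord_eq, im_ofReal_mul]
  simp [div_eq_inv_mul]

theorem inv_cuspCoord_re (k : ℕ) (y θ : ℝ) : (cuspCoord k y θ)⁻¹.re = k ^ 2 * y := by
  rw [cuspCoord, inv_inv, ← ofReal_natCast, ← ofReal_pow, re_ofReal_mul]
  simp

theorem norm_cuspCoord (k : ℕ) (y θ : ℝ) : ‖cuspCoord k y θ‖ = (k ^ 2 * ‖(y - θ * I : ℂ)‖)⁻¹ := by
  rw [cuspCoord, norm_inv, norm_mul, norm_pow, Complex.norm_natCast]

theorem cuspCoord_re_pos (hk : 0 < k) (hy : 0 < y) (θ : ℝ) : 0 < (cuspCoord k y θ).re := by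
  rw [cuspCoord_re]
  positivity

theorem cuspCoord_ne_zero (hk : 0 < k) (hy : 0 < y) (θ : ℝ) : cuspCoord k y θ ≠ 0 :=
  ne_zero_of_re_pos (cuspCoord_re_pos hk hy θ)

theorem hasDerivAt_cuspCoord (hk : 0 < k) (hy : 0 < y) (θ : ℝ) :
    HasDerivAt (cuspCoord k y) (I * k ^ 2 * cuspCoord k y θ ^ 2) θ := by
  have hne : (k ^ 2 * (y - θ * I) : ℂ) ≠ 0 :=
    inv_eq_zero.not.mp (cuspCoord_ne_zero hk hy θ)
  have hlin : HasDerivAt (fun θ : ℝ => (k ^ 2 * (y - θ * I) : ℂ)) (k ^ 2 * (-(1 * I))) θ :=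
    (((hasDerivAt_id θ).ofReal_comp.mul_const I).const_sub (y : ℂ)).const_mul _
  refine (hlin.inv hne).congr_deriv ?_
  rw [cuspCoord]
  field_simp

theorem hasDerivAt_cuspCoord_unit_mul (hk : 0 < k) (hy : 0 < y) (ε : ℤˣ) (θ : ℝ) :
    HasDerivAt (fun θ : ℝ => cuspCoord k y ((ε : ℤ) * θ))
      ((ε : ℤ) * (I * k ^ 2 * cuspCoord k y ((ε : ℤ) * θ) ^ 2)) θ := by
  simpa [Function.comp_def] using
    (hasDerivAt_cuspCoord hk hy _).scomp θ ((hasDerivAt_id θ).const_mul ((ε : ℤ) : ℝ))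

theorem continuous_cuspCoord (hk : 0 < k) (hy : 0 < y) : Continuous (cuspCoord k y) :=
  continuous_iff_continuousAt.mpr fun θ => (hasDerivAt_cuspCoord hk hy θ).continuousAt

theorem half_le_cuspCoord_re {N : ℕ} (hk : 0 < k) (hkN : k ≤ N) {θ : ℝ}
    (hθ : |θ| ≤ 1 / (k * N)) : 1 / 2 ≤ (cuspCoord k (1 / N ^ 2) θ).re := by
  have hN : 0 < N := hk.trans_le hkN
  have hθ_sq : θ ^ 2 ≤ (1 / (k * N)) ^ 2 := sq_le_sq' (abs_le.mp hθ).1 (abs_le.mp hθ).2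
  have hy_sq : (1 / (N : ℝ) ^ 2) ^ 2 ≤ (1 / (k * N)) ^ 2 := by
    rw [sq (N : ℝ)]
    gcongr
  rw [cuspCoord_re, le_div_iff₀ (by positivity)]
  calc (1 / 2 : ℝ) * (k ^ 2 * ((1 / N ^ 2) ^ 2 + θ ^ 2))
    _ ≤ 1 / 2 * (k ^ 2 * ((1 / (k * N)) ^ 2 + (1 / (k * N)) ^ 2)) := by gcongr
    _ = 1 / (N : ℝ) ^ 2 := by
      field_simp
      norm_num

theorem half_le_mul_norm_cuspCoord {N : ℕ} (hk : 0 < k) (hkN : k ≤ N) {θ : ℝ}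
    (hθ : |θ| ≤ 1 / (k * N)) : N / 2 ≤ k * ‖cuspCoord k (1 / N ^ 2) θ‖ := by
  have hN : 0 < N := hk.trans_le hkN
  have hy : 0 < (1 / N ^ 2 : ℝ) := by positivity
  have hpos : 0 < ‖((1 / N ^ 2 : ℝ) - θ * I : ℂ)‖ :=
    norm_pos_iff.mpr (ne_zero_of_re_pos (by simpa only [sub_re, ofReal_re, re_ofReal_mul, I_re,
      mul_zero, sub_zero] using hy))
  have hle : ‖((1 / N ^ 2 : ℝ) - θ * I : ℂ)‖ ≤ 2 / (k * N) := by
    calc ‖((1 / N ^ 2 : ℝ) - θ * I : ℂ)‖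
      _ ≤ ‖((1 / N ^ 2 : ℝ) : ℂ)‖ + ‖(θ * I : ℂ)‖ := norm_sub_le _ _
      _ = 1 / (N * N) + |θ| := by
        rw [norm_mul, norm_I, mul_one, norm_real, norm_real, Real.norm_of_nonneg hy.le, sq,
          Real.norm_eq_abs]
      _ ≤ 1 / (k * N) + 1 / (k * N) := by gcongr
      _ = 2 / (k * N) := by ring
  calc (N / 2 : ℝ) = k * ((k : ℝ) ^ 2 * (2 / (k * N)))⁻¹ := by field_simp
    _ ≤ k * (k ^ 2 * ‖((1 / N ^ 2 : ℝ) - θ * I : ℂ)‖)⁻¹ := by gcongr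
    _ = k * ‖cuspCoord k (1 / N ^ 2) θ‖ := by rw [norm_cuspCoord]

end CuspCoordinate

section FareyMediant

open Complex

variable {N k l : ℕ}

theorem le_add_of_mem_fareyDenoms (hl : l ∈ fareyDenoms N k) : (N : ℝ) ≤ k + l := by
  simp only [fareyDenoms, Finset.mem_filter, Finset.mem_Ioc] at hl
  exact_mod_cast (by omega : N ≤ k + l)

theorem add_le_of_mem_fareyDenoms (hkN : k ≤ N) (hl : l ∈ fareyDenoms N k) :
    (k + l : ℝ) ≤ 2 * N := by
  simp only [fareyDenoms, Finset.mem_filter, Finset.mem_Ioc] at hl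
  exact_mod_cast (by omega : k + l ≤ 2 * N)

theorem halfArc_length_le (hk : 0 < k) (hkN : k ≤ N) (hl : l ∈ fareyDenoms N k) :
    (1 / (k * (k + l)) : ℝ) ≤ 1 / (k * N) := by
  have hN : 0 < N := hk.trans_le hkN
  have := le_add_of_mem_fareyDenoms hl
  gcongr

theorem abs_unit_mul (ε : ℤˣ) (θ : ℝ) : |((ε : ℤ) : ℝ) * θ| = |θ| := by
  rcases Int.units_eq_one_or ε with rfl | rfl <;> simp

theorem cuspCoord_unit_mul (k : ℕ) (y θ : ℝ) (ε : ℤˣ) :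
    cuspCoord k y ((ε : ℤ) * θ) = (cuspCoord k y θ).re + (ε : ℤ) * (cuspCoord k y θ).im * I := by
  rw [cuspCoord_re, cuspCoord_im, cuspCoord_eq]
  rcases Int.units_eq_one_or ε with rfl | rfl <;>
  · push_cast
    ring

theorem exists_cuspCoord_mediant_eq (hk : 0 < k) (hkN : k ≤ N) (hl : l ∈ fareyDenoms N k) :
    ∃ u v : ℝ, u ∈ Set.Icc (1 / 2) 4 ∧ N / (5 * k) ≤ v ∧ ∀ ε : ℤˣ,
      cuspCoord k (1 / N ^ 2) ((ε : ℤ) * (1 / (k * (k + l)) : ℝ)) = u + (ε : ℤ) * v * I := by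
  have hN : 0 < N := hk.trans_le hkN
  have hm_le := add_le_of_mem_fareyDenoms hkN hl
  have hθ_le := halfArc_length_le hk hkN hl
  have hθ : (0 : ℝ) < 1 / (k * (k + l)) := by positivity
  have hkθ : (1 / (2 * N) : ℝ) ≤ k * (1 / (k * (k + l))) := by
    rw [mul_one_div, div_mul_cancel_left₀ (by positivity), ← one_div]
    gcongr
  generalize (1 / (k * (k + l)) : ℝ) = θ at *
  refine ⟨(cuspCoord k (1 / N ^ 2) θ).re, (cuspCoord k (1 / N ^ 2) θ).im,
    ⟨half_le_cuspCoord_re hk hkN (by rwa [abs_of_pos hθ]), ?_⟩, ?_, cuspCoord_unit_mul _ _ _⟩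
  · rw [cuspCoord_re, div_le_iff₀ (by positivity)]
    calc (1 / N ^ 2 : ℝ) = 4 * (1 / (2 * N)) ^ 2 := by ring
      _ ≤ 4 * (k * θ) ^ 2 := by gcongr
      _ = 4 * (k ^ 2 * (0 + θ ^ 2)) := by ring
      _ ≤ 4 * (k ^ 2 * ((1 / N ^ 2) ^ 2 + θ ^ 2)) := by
        gcongr
        positivity
  · have hy : (1 / N ^ 2 : ℝ) ≤ 2 * θ := by
      calc (1 / N ^ 2 : ℝ) = 2 * (1 / (2 * N) / N) := by field_simp
        _ ≤ 2 * (k * θ / N) := by gcongr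
        _ ≤ 2 * θ := by
          gcongr
          rw [div_le_iff₀ (by positivity), mul_comm]
          gcongr
    rw [cuspCoord_im, div_le_div_iff₀ (by positivity) (by positivity)]
    calc (N : ℝ) * (k ^ 2 * ((1 / N ^ 2) ^ 2 + θ ^ 2))
      _ ≤ N * (k ^ 2 * ((2 * θ) ^ 2 + θ ^ 2)) := by gcongr
      _ = 5 * k * θ * (θ * (k * N)) := by ring
      _ ≤ 5 * k * θ * (1 / (k * N) * (k * N)) := by gcongr
      _ = θ * (5 * k) := by field_simp

end FareyMediant

section MainTerm

open Complex

variable {n k d : ℕ} {y θ : ℝ}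

/-- The parameter `b` of the Bessel kernel `besselKernel s a b` that governs the contribution to
`p n` of the cusps with denominator `k`. -/
def cuspParam (n k : ℕ) : ℝ := 2 * Real.pi * (n - 1 / 24) / k ^ 2

theorem cuspParam_nonneg (hn : 1 ≤ n) (k : ℕ) : 0 ≤ cuspParam n k := by
  have hnR : (1 : ℝ) ≤ n := by exact_mod_cast hn
  have hshift : (0 : ℝ) ≤ n - 1 / 24 := by linarith
  have := Real.pi_pos
  unfold cuspParam
  positivity

theorem cuspParam_mul_inv_cuspCoord_re_le (n : ℕ) (hk : 0 < k) (hy : 0 ≤ y) (θ : ℝ) :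
    cuspParam n k * (cuspCoord k y θ)⁻¹.re ≤ 2 * Real.pi * n * y := by
  have := Real.pi_pos
  calc cuspParam n k * (cuspCoord k y θ)⁻¹.re
    _ = 2 * Real.pi * (n - 1 / 24) * y := by
      rw [inv_cuspCoord_re, cuspParam]
      field_simp
    _ ≤ 2 * Real.pi * n * y := by
      gcongr
      linarith

theorem cuspParam_le (n : ℕ) (hk : 0 < k) : cuspParam n k ≤ 2 * Real.pi * n := by
  have hkR : (1 : ℝ) ≤ k := by exact_mod_cast hk
  have := Real.pi_pos
  calc cuspParam n k ≤ 2 * Real.pi * n / k ^ 2 := by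
        unfold cuspParam
        gcongr
        linarith
    _ ≤ 2 * Real.pi * n := div_le_self (by positivity) (one_le_pow₀ hkR)

/-- The function of the coordinate `w` that replaces `integrand n` near the cusp `-d / k`; it is
`integrand n` with the factor `partGen` coming from the modular transformation set to `1`. -/
def mainTerm (n k d : ℕ) (w : ℂ) : ℂ :=
  cuspCoeff n k d * ((k : ℂ) ^ (-1 / 2 : ℂ) *
    besselKernel (1 / 2) (Real.pi / 12) (cuspParam n k) w)

theorem norm_mainTerm (n k d : ℕ) (w : ℂ) :
    ‖mainTerm n k d w‖ = (k * ‖w‖) ^ (-1 / 2 : ℝ) *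
      Real.exp (Real.pi / 12 * w.re + cuspParam n k * w⁻¹.re) := by
  have hexp : ((-1 / 2 : ℝ) : ℂ) = -1 / 2 := by push_cast; rfl
  rw [mainTerm, besselKernel, norm_mul, norm_cuspCoeff, one_mul, norm_mul, norm_mul,
    Real.mul_rpow k.cast_nonneg (norm_nonneg w), ← hexp, norm_cpow_real, Complex.norm_natCast,
    ← ofReal_neg, norm_cpow_real, ← neg_div, norm_exp, add_re, re_ofReal_mul,
    div_eq_mul_inv (_ : ℂ), re_ofReal_mul, mul_assoc]

theorem mainTerm_eq_deriv_mul (n d : ℕ) (hk : 0 < k) {w : ℂ} (hw : w ≠ 0) :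
    mainTerm n k d w = cuspCoeff n k d * ((k : ℝ) ^ (-5 / 2 : ℝ) : ℝ) *
      (besselKernel (5 / 2) (Real.pi / 12) (cuspParam n k) w * (k ^ 2 * w ^ 2)) := by
  have hkC : (k : ℂ) ≠ 0 := by exact_mod_cast hk.ne'
  have hwpow : w ^ (-(1 / 2 : ℝ) : ℂ) = w ^ (-(5 / 2 : ℝ) : ℂ) * w ^ 2 := by
    rw [← cpow_natCast w 2, ← cpow_add _ _ hw]
    norm_num
  have hkpow : (k : ℂ) ^ (-1 / 2 : ℂ) = (((k : ℝ) ^ (-5 / 2 : ℝ) : ℝ) : ℂ) * k ^ 2 := by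
    rw [ofReal_cpow k.cast_nonneg, ← cpow_natCast (k : ℂ) 2, ofReal_natCast, ← cpow_add _ _ hkC]
    norm_num
  rw [mainTerm, besselKernel, besselKernel, hwpow, hkpow]
  ring

theorem cusp_add_eq (d : ℕ) (hk : 0 < k) (y θ : ℝ) :
    ((-(d : ℝ) / k + θ : ℝ) : ℂ) + y * I = -d / k + I / (k ^ 2 * cuspCoord k y θ) := by
  have hkC : (k : ℂ) ≠ 0 := by exact_mod_cast hk.ne'
  rw [cuspCoord, mul_inv, mul_inv_cancel_left₀ (pow_ne_zero 2 hkC), div_inv_eq_mul]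
  push_cast
  linear_combination (θ : ℂ) * I_sq

theorem integrand_eq_mainTerm_mul (n : ℕ) (hk : 0 < k) (hd : Nat.Coprime k d) (hy : 0 < y)
    (θ : ℝ) :
    integrand n ((-(d : ℝ) / k + θ : ℝ) + y * I) = mainTerm n k d (cuspCoord k y θ) *
      partGen (exp (2 * Real.pi * I *
        ((matrixOfBottomRow k d 0 0 : ℂ) / k + I * cuspCoord k y θ))) := by
  rw [cusp_add_eq d hk, integrand_cusp n hk hd (cuspCoord_re_pos hk hy θ), mainTerm, besselKernel,
    cuspParam]
  push_cast
  ring_nf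

theorem norm_exp_two_pi_I_mul_add_I_mul (a : ℤ) (k : ℕ) (w : ℂ) :
    ‖exp (2 * Real.pi * I * ((a : ℂ) / k + I * w))‖ = Real.exp (-(2 * Real.pi * w.re)) := by
  rw [norm_exp_two_pi_I_mul, add_im, I_mul_im,
    show ((a : ℂ) / k) = (((a : ℝ) / k : ℝ) : ℂ) by push_cast; rfl, ofReal_im, zero_add]

theorem exists_norm_integrand_sub_mainTerm_le :
    ∃ C : ℝ, 0 ≤ C ∧ ∀ n k d : ℕ, ∀ y θ : ℝ, 0 < k → Nat.Coprime k d → 0 < y →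
      1 / 2 ≤ (cuspCoord k y θ).re →
      ‖integrand n ((-(d : ℝ) / k + θ : ℝ) + y * I) - mainTerm n k d (cuspCoord k y θ)‖
        ≤ C * Real.exp (2 * Real.pi * n * y) * (k * ‖cuspCoord k y θ‖) ^ (-1 / 2 : ℝ) := by
  have hπ := Real.pi_pos
  obtain ⟨C, hC, hgen⟩ := exists_norm_partGen_sub_one_le (𝕜 := ℂ) (Real.exp_pos (-Real.pi))
    (by simpa using hπ)
  refine ⟨C, hC, fun n k d y θ hk hd hy hre => ?_⟩
  have hparam := cuspParam_mul_inv_cuspCoord_re_le n hk hy.le θ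
  rw [integrand_eq_mainTerm_mul n hk hd hy, ← mul_sub_one, norm_mul, norm_mainTerm]
  set w := cuspCoord k y θ
  set q := exp (2 * Real.pi * I * ((matrixOfBottomRow k d 0 0 : ℂ) / k + I * w))
  have hq : ‖q‖ = Real.exp (-(2 * Real.pi * w.re)) := norm_exp_two_pi_I_mul_add_I_mul _ k w
  have hq_le : ‖q‖ ≤ Real.exp (-Real.pi) := by
    rw [hq, Real.exp_le_exp]
    nlinarith
  have hexp : Real.exp (Real.pi / 12 * w.re + cuspParam n k * w⁻¹.re) * ‖q‖
      ≤ Real.exp (2 * Real.pi * n * y) := by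
    rw [hq, ← Real.exp_add, Real.exp_le_exp]
    nlinarith
  calc (k * ‖w‖) ^ (-1 / 2 : ℝ) * Real.exp (Real.pi / 12 * w.re + cuspParam n k * w⁻¹.re) *
        ‖partGen q - 1‖
    _ ≤ (k * ‖w‖) ^ (-1 / 2 : ℝ) * Real.exp (Real.pi / 12 * w.re + cuspParam n k * w⁻¹.re) *
        (C * ‖q‖) := by
      gcongr
      exact hgen q hq_le
    _ = C * (Real.exp (Real.pi / 12 * w.re + cuspParam n k * w⁻¹.re) * ‖q‖) *
        (k * ‖w‖) ^ (-1 / 2 : ℝ) := by ring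
    _ ≤ C * Real.exp (2 * Real.pi * n * y) * (k * ‖w‖) ^ (-1 / 2 : ℝ) := by gcongr

theorem exists_norm_integrand_sub_mainTerm_le_rpow (n : ℕ) :
    ∃ C : ℝ, 0 ≤ C ∧ ∀ N k d : ℕ, 0 < k → k ≤ N → Nat.Coprime k d → ∀ θ : ℝ,
      |θ| ≤ 1 / (k * N) →
      ‖integrand n ((-(d : ℝ) / k + θ : ℝ) + (1 / N ^ 2 : ℝ) * I)
        - mainTerm n k d (cuspCoord k (1 / N ^ 2) θ)‖ ≤ C * (N : ℝ) ^ (-1 / 2 : ℝ) := by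
  obtain ⟨C, hC, hle⟩ := exists_norm_integrand_sub_mainTerm_le
  refine ⟨C * Real.exp (2 * Real.pi * n) * (1 / 2) ^ (-1 / 2 : ℝ), by positivity,
    fun N k d hk hkN hd θ hθ => ?_⟩
  have hN : (1 : ℝ) ≤ N := by exact_mod_cast hk.trans_le hkN
  have hNpos : 0 < N := hk.trans_le hkN
  have hy : (1 / N ^ 2 : ℝ) ≤ 1 := (div_le_one (by positivity)).mpr (one_le_pow₀ hN)
  have hexp : Real.exp (2 * Real.pi * n * (1 / N ^ 2)) ≤ Real.exp (2 * Real.pi * n) := by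
    have := Real.pi_pos
    exact Real.exp_le_exp.mpr (mul_le_of_le_one_right (by positivity) hy)
  have hpow : (k * ‖cuspCoord k (1 / N ^ 2) θ‖) ^ (-1 / 2 : ℝ)
      ≤ (1 / 2 * N : ℝ) ^ (-1 / 2 : ℝ) := by
    refine Real.rpow_le_rpow_of_nonpos (by positivity) ?_ (by norm_num)
    rw [one_div_mul_eq_div]
    exact half_le_mul_norm_cuspCoord hk hkN hθ
  rw [mul_assoc (C * _), ← Real.mul_rpow (by norm_num) N.cast_nonneg]
  exact (hle n k d _ θ hk hd (by positivity) (half_le_cuspCoord_re hk hkN hθ)).trans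
    (mul_le_mul (mul_le_mul_of_nonneg_left hexp hC) hpow (by positivity) (by positivity))

theorem continuous_mainTerm_cuspCoord (n d : ℕ) (hk : 0 < k) (hy : 0 < y) :
    Continuous fun θ => mainTerm n k d (cuspCoord k y θ) :=
  (((differentiableOn_besselKernel _ _ _).continuousOn.comp_continuous
    (continuous_cuspCoord hk hy) (cuspCoord_re_pos hk hy)).const_mul _).const_mul _

theorem integral_mainTerm (d : ℕ) (hk : 0 < k) (hy : 0 < y) {Φ : ℂ → ℂ}
    (hΦ : ∀ w, 0 < w.re →
      HasDerivAt Φ (besselKernel (5 / 2) (Real.pi / 12) (cuspParam n k) w) w) (ε : ℤˣ) (T : ℝ) :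
    ∫ θ in (0 : ℝ)..T, mainTerm n k d (cuspCoord k y ((ε : ℤ) * θ))
      = cuspCoeff n k d * ((k : ℝ) ^ (-5 / 2 : ℝ) : ℝ) *
        (-I * (ε : ℤ) * (Φ (cuspCoord k y ((ε : ℤ) * T)) - Φ (cuspCoord k y 0))) := by
  have hε : ((ε : ℤ) : ℂ) ^ 2 = 1 := by
    rcases Int.units_eq_one_or ε with rfl | rfl <;> simp
  have hderiv : ∀ θ : ℝ, HasDerivAt (fun θ : ℝ => cuspCoeff n k d *
      ((k : ℝ) ^ (-5 / 2 : ℝ) : ℝ) * (-I * (ε : ℤ) * Φ (cuspCoord k y ((ε : ℤ) * θ))))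
      (mainTerm n k d (cuspCoord k y ((ε : ℤ) * θ))) θ := fun θ => by
    refine ((((hΦ _ (cuspCoord_re_pos hk hy ((ε : ℤ) * θ))).comp θ
      (hasDerivAt_cuspCoord_unit_mul hk hy ε θ)).const_mul _).const_mul _).congr_deriv ?_
    rw [mainTerm_eq_deriv_mul n d hk (cuspCoord_ne_zero hk hy _)]
    generalize cuspCoord k y ((ε : ℤ) * θ) = w
    generalize cuspCoeff n k d * ((k : ℝ) ^ (-5 / 2 : ℝ) : ℝ) = A
    generalize besselKernel (5 / 2) (Real.pi / 12) (cuspParam n k) w = K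
    linear_combination A * K * k ^ 2 * w ^ 2 * (-I ^ 2 * hε - I_sq)
  rw [intervalIntegral.integral_eq_sub_of_hasDerivAt (fun θ _ => hderiv θ)
    (((continuous_mainTerm_cuspCoord n d hk hy).comp
      (continuous_const.mul continuous_id)).intervalIntegrable _ _), mul_zero]
  ring

end MainTerm

section HalfArc

open Complex MeasureTheory

variable {n N k l : ℕ}

theorem rpow_mul_rpow_le_of_div_le (hk : 0 < k) (hN : 0 < N) {v : ℝ} (hv : N / (5 * k) ≤ v) :
    (k : ℝ) ^ (-5 / 2 : ℝ) * v ^ (-3 / 2 : ℝ)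
      ≤ (1 / 5 : ℝ) ^ (-3 / 2 : ℝ) * ((N : ℝ) ^ (-3 / 2 : ℝ) / k) := by
  have hkR : (0 : ℝ) < k := by exact_mod_cast hk
  calc (k : ℝ) ^ (-5 / 2 : ℝ) * v ^ (-3 / 2 : ℝ)
    _ ≤ (k : ℝ) ^ (-5 / 2 : ℝ) * (1 / 5 * (N / k)) ^ (-3 / 2 : ℝ) := by
      refine mul_le_mul_of_nonneg_left ?_ (by positivity)
      refine Real.rpow_le_rpow_of_nonpos (by positivity) ?_ (by norm_num)
      rwa [div_mul_div_comm, one_mul]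
    _ = (1 / 5 : ℝ) ^ (-3 / 2 : ℝ) * ((N : ℝ) ^ (-3 / 2 : ℝ) / k) := by
      rw [show (-5 / 2 : ℝ) = -3 / 2 - 1 by norm_num, Real.rpow_sub_one hkR.ne',
        Real.mul_rpow (by norm_num) (by positivity), Real.div_rpow N.cast_nonneg hkR.le]
      field_simp

theorem exists_norm_halfArc_sub_le (n : ℕ) :
    ∃ C : ℝ, 0 ≤ C ∧ ∀ (N k l : ℕ) (ε : ℤˣ) (Φ : ℂ → ℂ), 0 < k → k ≤ N → l ∈ fareyDenoms N k →
      (∀ w, 0 < w.re →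
        HasDerivAt Φ (besselKernel (5 / 2) (Real.pi / 12) (cuspParam n k) w) w) →
      ‖halfArc (fun x => integrand n (x + (1 / N ^ 2 : ℝ) * I)) ε k l
        - cuspCoeff n k (invRes ε k l) * ((k : ℝ) ^ (-5 / 2 : ℝ) : ℝ) *
          (-I * (ε : ℤ) * (Φ (cuspCoord k (1 / N ^ 2) ((ε : ℤ) * (1 / (k * (k + l)) : ℝ)))
            - Φ (cuspCoord k (1 / N ^ 2) 0)))‖
        ≤ C * ((N : ℝ) ^ (-3 / 2 : ℝ) / k) := by
  obtain ⟨C, hC, hle⟩ := exists_norm_integrand_sub_mainTerm_le_rpow n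
  refine ⟨C, hC, fun N k l ε Φ hk hkN hl hΦ => ?_⟩
  have hNR : (0 : ℝ) < N := by exact_mod_cast hk.trans_le hkN
  have hy : (0 : ℝ) < 1 / N ^ 2 := by positivity
  have hd : Nat.Coprime k (invRes ε k l) := coprime_invRes ε hk (Finset.mem_filter.mp hl).2
  have hT : (0 : ℝ) ≤ 1 / (k * (k + l)) := by positivity
  have hT_le := halfArc_length_le hk hkN hl
  have hline : Continuous fun θ : ℝ => (fun x : ℝ => integrand n (x + (1 / N ^ 2 : ℝ) * I))
      (-(invRes ε k l : ℝ) / k + (ε : ℤ) * θ) :=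
    (continuous_integrand_line n hy).comp (by fun_prop)
  have hmain : Continuous fun θ : ℝ =>
      mainTerm n k (invRes ε k l) (cuspCoord k (1 / N ^ 2) ((ε : ℤ) * θ)) :=
    (continuous_mainTerm_cuspCoord n _ hk hy).comp (by fun_prop)
  rw [halfArc, ← integral_mainTerm _ hk hy hΦ, ← intervalIntegral.integral_sub
    (hline.intervalIntegrable _ _) (hmain.intervalIntegrable _ _)]
  calc _ ≤ C * (N : ℝ) ^ (-1 / 2 : ℝ) * |(1 / (k * (k + l)) : ℝ) - 0| := by
        refine intervalIntegral.norm_integral_le_of_norm_le_const fun θ hθ => ?_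
        rw [Set.uIoc_of_le hT] at hθ
        refine hle N k _ hk hkN hd _ ?_
        rw [abs_unit_mul, abs_of_pos hθ.1]
        exact hθ.2.trans hT_le
    _ ≤ C * (N : ℝ) ^ (-1 / 2 : ℝ) * (1 / (k * N)) := by
      rw [sub_zero, abs_of_nonneg hT]
      gcongr
    _ = C * ((N : ℝ) ^ (-3 / 2 : ℝ) / k) := by
      rw [show (-3 / 2 : ℝ) = -1 / 2 - 1 by norm_num, Real.rpow_sub_one hNR.ne']
      field_simp

theorem norm_cuspCoeff_mul_le (ε : ℤˣ) {d : ℕ} (hk : 0 < k) (hN : 0 < N) {v E : ℝ} {Z : ℂ}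
    (hv : N / (5 * k) ≤ v) (hE : 0 ≤ E) (hZ : ‖Z‖ ≤ E * v ^ (-3 / 2 : ℝ)) :
    ‖cuspCoeff n k d * ((k : ℝ) ^ (-5 / 2 : ℝ) : ℝ) * (-I * (ε : ℤ) * Z)‖
      ≤ E * (1 / 5 : ℝ) ^ (-3 / 2 : ℝ) * ((N : ℝ) ^ (-3 / 2 : ℝ) / k) := by
  rw [norm_mul, norm_mul, norm_cuspCoeff, one_mul, norm_real, Real.norm_of_nonneg (by positivity),
    norm_mul, neg_mul, norm_neg, mul_comm I, norm_unit_mul_I, one_mul]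
  calc (k : ℝ) ^ (-5 / 2 : ℝ) * ‖Z‖
    _ ≤ (k : ℝ) ^ (-5 / 2 : ℝ) * (E * v ^ (-3 / 2 : ℝ)) := by gcongr
    _ = E * ((k : ℝ) ^ (-5 / 2 : ℝ) * v ^ (-3 / 2 : ℝ)) := by ring
    _ ≤ E * ((1 / 5 : ℝ) ^ (-3 / 2 : ℝ) * ((N : ℝ) ^ (-3 / 2 : ℝ) / k)) := by
      gcongr ?_ * ?_
      exact rpow_mul_rpow_le_of_div_le hk hN hv
    _ = E * (1 / 5 : ℝ) ^ (-3 / 2 : ℝ) * ((N : ℝ) ^ (-3 / 2 : ℝ) / k) := by ring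

theorem exists_norm_halfArc_sub_limit_le (hn : 1 ≤ n) :
    ∃ C : ℝ, 0 ≤ C ∧ ∀ N k : ℕ, 0 < k → k ≤ N → ∃ R : ℤˣ → ℂ,
      R 1 + R (-1) = lineIntegral (5 / 2) (Real.pi / 12) (cuspParam n k) ∧
      ∀ (ε : ℤˣ), ∀ l ∈ fareyDenoms N k,
        ‖halfArc (fun x => integrand n (x + (1 / N ^ 2 : ℝ) * I)) ε k l
          - cuspCoeff n k (invRes ε k l) * ((k : ℝ) ^ (-5 / 2 : ℝ) : ℝ) * R ε‖
          ≤ C * ((N : ℝ) ^ (-3 / 2 : ℝ) / k) := by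
  obtain ⟨C, hC, harc⟩ := exists_norm_halfArc_sub_le n
  set E := Real.exp (4 * (Real.pi / 12) + 2 * (2 * Real.pi * n))
  refine ⟨C + E * (1 / 5 : ℝ) ^ (-3 / 2 : ℝ), by positivity, fun N k hk hkN => ?_⟩
  obtain ⟨Φ, L, hΦ, hL, htail⟩ := exists_primitive_besselKernel_limits (s := 5 / 2) (by norm_num)
    (by positivity : 0 ≤ Real.pi / 12) (cuspParam_nonneg hn k)
  set z := Φ (cuspCoord k (1 / N ^ 2) 0)
  refine ⟨fun ε => -I * (ε : ℤ) * (L ε - z), ?_, fun ε l hl => ?_⟩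
  · simp only [Units.val_one, Units.val_neg, Int.cast_one, Int.cast_neg]
    linear_combination -I * hL - lineIntegral (5 / 2) (Real.pi / 12) (cuspParam n k) * I_sq
  obtain ⟨u, v, hu, hv, hcoord⟩ := exists_cuspCoord_mediant_eq hk hkN hl
  have hN : 0 < N := hk.trans_le hkN
  have hlimit : ‖L ε - Φ (u + (ε : ℤ) * v * I)‖ ≤ E * v ^ (-3 / 2 : ℝ) := by
    have hv0 : 0 < v := lt_of_lt_of_le (by positivity) hv
    calc ‖L ε - Φ (u + (ε : ℤ) * v * I)‖
      _ ≤ Real.exp (4 * (Real.pi / 12) + 2 * cuspParam n k) *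
          (v ^ (1 - 5 / 2 : ℝ) / (5 / 2 - 1)) := htail ε u v hu hv0
      _ ≤ E * v ^ (1 - 5 / 2 : ℝ) := by
        gcongr
        · exact Real.exp_le_exp.mpr (by linarith [cuspParam_le n hk])
        · exact div_le_self (by positivity) (by norm_num)
      _ = E * v ^ (-3 / 2 : ℝ) := by norm_num
  have herror := norm_cuspCoeff_mul_le (n := n) (d := invRes ε k l) ε hk hN hv (by positivity)
    hlimit
  have hmain := harc N k l ε Φ hk hkN hl hΦ
  rw [hcoord] at hmain
  rw [add_mul]
  refine le_trans (le_of_eq ?_) ((norm_sub_le _ _).trans (add_le_add hmain herror))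
  congr 1
  ring

end HalfArc

/-! ### Rademacher's series -/

section Series

open Complex Filter Finset
open scoped Topology

variable {n : ℕ}

/-- The `k`-th term of Rademacher's series before the line integral is evaluated: the total
contribution to `p n` of the cusps with denominator `k`. -/
def seriesTerm (n k : ℕ) : ℂ :=
  A k n * ((k : ℝ) ^ (-5 / 2 : ℝ) : ℝ) * lineIntegral (5 / 2) (Real.pi / 12) (cuspParam n k)

theorem seriesTerm_eq_sum_fareyDenoms {N k : ℕ} (hk : 0 < k) (hkN : k ≤ N) {R : ℤˣ → ℂ}
    (hR : R 1 + R (-1) = lineIntegral (5 / 2) (Real.pi / 12) (cuspParam n k)) :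
    seriesTerm n k = ∑ l ∈ fareyDenoms N k,
      (cuspCoeff n k (invRes 1 k l) * ((k : ℝ) ^ (-5 / 2 : ℝ) : ℝ) * R 1
        + cuspCoeff n k (invRes (-1) k l) * ((k : ℝ) ^ (-5 / 2 : ℝ) : ℝ) * R (-1)) := by
  have hA (ε : ℤˣ) : ∑ l ∈ fareyDenoms N k, cuspCoeff n k (invRes ε k l) = A k n := by
    rw [sum_fareyDenoms_invRes ε hk hkN (cuspCoeff n k), A_eq_sum_cuspCoeff]
  rw [sum_add_distrib, ← sum_mul, ← sum_mul, ← sum_mul, ← sum_mul, hA, hA, ← mul_add, hR,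
    seriesTerm]

theorem exists_norm_sum_halfArc_sub_seriesTerm_le (hn : 1 ≤ n) :
    ∃ C : ℝ, ∀ N k : ℕ, 0 < k → k ≤ N →
      ‖∑ l ∈ fareyDenoms N k, (halfArc (fun x => integrand n (x + (1 / N ^ 2 : ℝ) * I)) 1 k l
        + halfArc (fun x => integrand n (x + (1 / N ^ 2 : ℝ) * I)) (-1) k l) - seriesTerm n k‖
      ≤ C * (N : ℝ) ^ (-3 / 2 : ℝ) := by
  obtain ⟨C, hC, happrox⟩ := exists_norm_halfArc_sub_limit_le hn
  refine ⟨2 * C, fun N k hk hkN => ?_⟩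
  obtain ⟨R, hR, harc⟩ := happrox N k hk hkN
  rw [seriesTerm_eq_sum_fareyDenoms hk hkN hR, ← sum_sub_distrib]
  calc _ ≤ ∑ l ∈ fareyDenoms N k, 2 * (C * ((N : ℝ) ^ (-3 / 2 : ℝ) / k)) := by
        refine norm_sum_le_of_le _ fun l hl => ?_
        rw [add_sub_add_comm, two_mul]
        exact norm_add_le_of_le (harc 1 l hl) (harc (-1) l hl)
    _ = k.totient * (2 * (C * ((N : ℝ) ^ (-3 / 2 : ℝ) / k))) := by
      rw [sum_const, nsmul_eq_mul, card_fareyDenoms hkN]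
    _ ≤ k * (2 * (C * ((N : ℝ) ^ (-3 / 2 : ℝ) / k))) := by
      gcongr
      exact k.totient_le
    _ = 2 * C * (N : ℝ) ^ (-3 / 2 : ℝ) := by field_simp

theorem exists_norm_sub_sum_seriesTerm_le (hn : 1 ≤ n) :
    ∃ C : ℝ, ∀ N : ℕ, 1 ≤ N →
      ‖(p n : ℂ) - ∑ k ∈ Icc 1 N, seriesTerm n k‖ ≤ C * (N : ℝ) ^ (-1 / 2 : ℝ) := by
  obtain ⟨C, hC⟩ := exists_norm_sum_halfArc_sub_seriesTerm_le hn
  refine ⟨C, fun N hN => ?_⟩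
  have hNR : (0 : ℝ) < N := by exact_mod_cast hN
  have hy : (0 : ℝ) < 1 / N ^ 2 := by positivity
  have hper : Function.Periodic (fun x : ℝ => integrand n (x + (1 / N ^ 2 : ℝ) * I)) 1 := by
    intro x
    simp only [ofReal_add, ofReal_one, add_right_comm (x : ℂ) 1, integrand_add_one]
  rw [← integral_integrand n hy, integral_eq_sum_halfArc hper (continuous_integrand_line n hy) hN,
    ← sum_sub_distrib]
  calc _ ≤ ∑ _k ∈ Icc 1 N, C * (N : ℝ) ^ (-3 / 2 : ℝ) :=
        norm_sum_le_of_le _ fun _ hk => hC N _ (mem_Icc.mp hk).1 (mem_Icc.mp hk).2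
    _ = N * (C * (N : ℝ) ^ (-3 / 2 : ℝ)) := by simp
    _ = C * (N : ℝ) ^ (-1 / 2 : ℝ) := by
      rw [show (-3 / 2 : ℝ) = -1 / 2 - 1 by norm_num, Real.rpow_sub_one hNR.ne']
      field_simp

theorem seriesTerm_zero (n : ℕ) : seriesTerm n 0 = 0 := by
  simp [seriesTerm, A_eq_sum_cuspCoeff]

theorem norm_seriesTerm_le (hn : 1 ≤ n) (k : ℕ) :
    ‖seriesTerm n k‖ ≤ (k : ℝ) ^ (-3 / 2 : ℝ) *
      (Real.exp (4 * (Real.pi / 12) + 2 * (2 * Real.pi * n)) * Real.pi) := by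
  have := Real.pi_pos
  rcases k.eq_zero_or_pos with rfl | hk
  · rw [seriesTerm_zero, norm_zero]
    positivity
  have hkR : (0 : ℝ) < k := by exact_mod_cast hk
  have hline : ‖lineIntegral (5 / 2) (Real.pi / 12) (cuspParam n k)‖
      ≤ Real.exp (4 * (Real.pi / 12) + 2 * (2 * Real.pi * n)) * Real.pi :=
    (norm_lineIntegral_le (by norm_num) (by positivity) (cuspParam_nonneg hn k)).trans (by
      gcongr
      exact cuspParam_le n hk)
  rw [seriesTerm, norm_mul, norm_mul, norm_real, Real.norm_of_nonneg (by positivity),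
    show (-3 / 2 : ℝ) = -5 / 2 + 1 by norm_num, Real.rpow_add_one hkR.ne', mul_comm (_ ^ _ : ℝ)]
  gcongr
  exact norm_A_le k n

theorem summable_seriesTerm (hn : 1 ≤ n) : Summable (seriesTerm n) :=
  .of_norm_bounded ((Real.summable_nat_rpow.mpr (by norm_num)).mul_right _) (norm_seriesTerm_le hn)

theorem tendsto_sum_Icc_seriesTerm (hn : 1 ≤ n) :
    Tendsto (fun N : ℕ => ∑ k ∈ Icc 1 N, seriesTerm n k) atTop (𝓝 (p n)) := by
  obtain ⟨C, hC⟩ := exists_norm_sub_sum_seriesTerm_le hn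
  have hbound : Tendsto (fun N : ℕ => C * (N : ℝ) ^ (-1 / 2 : ℝ)) atTop (𝓝 0) := by
    simpa [neg_div, Function.comp_def] using
      ((tendsto_rpow_neg_atTop (one_half_pos (α := ℝ))).comp
        tendsto_natCast_atTop_atTop).const_mul C
  simpa using (squeeze_zero_norm' ((eventually_ge_atTop 1).mono hC) hbound).const_sub (p n : ℂ)

theorem hasSum_seriesTerm (hn : 1 ≤ n) : HasSum (seriesTerm n) (p n) := by
  have hsum := (summable_seriesTerm hn).hasSum
  have hshift : ∀ N : ℕ, ∑ k ∈ range (N + 1), seriesTerm n k = ∑ k ∈ Icc 1 N, seriesTerm n k :=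
    fun N => by
      rw [range_eq_Ico, sum_eq_sum_Ico_succ_bot N.succ_pos, seriesTerm_zero, zero_add]
      rfl
  have hlim := (tendsto_add_atTop_iff_nat 1).mpr hsum.tendsto_sum_nat
  simp only [hshift] at hlim
  rwa [tendsto_nhds_unique hlim (tendsto_sum_Icc_seriesTerm hn)] at hsum

theorem hasSum_seriesTerm_pnat (hn : 1 ≤ n) : HasSum (fun c : ℕ+ => seriesTerm n c) (p n) := by
  refine (PNat.coe_injective.hasSum_iff fun k hk => ?_).mpr (hasSum_seriesTerm hn)
  rcases k.eq_zero_or_pos with rfl | hpos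
  · exact seriesTerm_zero n
  · exact absurd ⟨⟨k, hpos⟩, rfl⟩ hk

theorem seriesTerm_eq_deriv (hn : 1 ≤ n) {c : ℕ} (hc : 0 < c) :
    seriesTerm n c = (1 / (Real.pi * Real.sqrt 2) : ℂ) *
        (A c n * (Real.sqrt c : ℂ) *
          ((deriv (fun x : ℝ => Real.sinh (mu * Real.sqrt (x - 1 / 24) / c) /
            Real.sqrt (x - 1 / 24)) (n : ℝ) : ℝ) : ℂ)) := by
  have hnR : (1 : ℝ) ≤ n := by exact_mod_cast hn
  rw [seriesTerm, mul_assoc, cuspParam,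
    rpow_mul_lineIntegral_eq_deriv hc (by linarith : (1 / 24 : ℝ) < n)]
  push_cast
  ring

end Series

end Rademacher

end

theorem theorem1 (n : ℕ) (hn : 1 ≤ n) :
    HasSum
      (fun c : ℕ+ => (1 / (Real.pi * Real.sqrt 2) : ℂ) *
        (Rademacher.A c n * (Real.sqrt c : ℂ) *
          ((deriv (fun x : ℝ => Real.sinh (Rademacher.mu * Real.sqrt (x - 1 / 24) / c) /
            Real.sqrt (x - 1 / 24)) (n : ℝ) : ℝ) : ℂ)))
      (Rademacher.p n : ℂ) :=
  (Rademacher.hasSum_seriesTerm_pnat hn).congr_fun fun c =>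
    (Rademacher.seriesTerm_eq_deriv hn c.pos).symm
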